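/- Let $F$ be a free group of finite rank $n>1$ with free basis $\mathcal B=\{b_1,\dots,b_n\}$, and let $\mathcal W\subset F$ be a finite set of nontrivial elements. Let $T$ be the Cayley tree of $F$ with respect to $\mathcal B$ and let $\partial T$ be its boundary at infinity, that is, the space of infinite reduced words in the letters $b_i^{\pm1}$ with the topology induced by the product topology. For $w\in\mathcal W$ and $g\in F$ let $gw^{\infty}$ and $gw^{-\infty}$ be the limits in $\partial T$ of the sequences of vertices $(gw^{m})_{m\ge 0}$ and $(gw^{-m})_{m\ge 0}$. The decomposition space $\mathcal D$ is the quotient of $\partial T$, with the quotient topology, obtained by identifying $gw^{\infty}$ with $gw^{-\infty}$ for all $g\in F$ and $w\in\mathcal W$. A cut set in $\mathcal D$ is a subset whose complement is not connected. A cut point is a point $x$ such that $\{x\}$ is a cut set. A cut pair is a cut set $\{x,y\}$ consisting of two distinct points, neither of which is a cut point. A cut pair $\{x_0,x_1\}$ crosses a cut pair $\{y_0,y_1\}$ if $x_0$ and $x_1$ lie in different connected components of $\mathcal D\setminus\{y_0,y_1\}$. Proposition. The decomposition space $\mathcal D$ is homeomorphic to the circle if and only if all of the following conditions hold: 1. $\mathcal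 D$ is connected. 2. $\mathcal D$ has no cut points. 3. $\mathcal D$ has cut pairs. 4. Every cut pair in $\mathcal D$ is crossed by a cut pair. -/

import Mathlib

open Filter

/-- The boundary at infinity of the Cayley tree of a free group with respect to a basis
`b_1, …, b_n`: the infinite reduced words in the letters `b_i` (written `(i, true)`) and their
inverses (written `(i, false)`). These are the geodesic rays of the tree issuing from the vertex
`1`. The topology is the one induced from the product of the discrete spaces of letters: two
points are close when the two rays share a long initial segment. -/
def TreeBoundary (n : ℕ) : Type :=
  {ξ : ℕ → Fin n × Bool // ∀ k : ℕ, ¬ ((ξ k).1 = (ξ (k + 1)).1 ∧ (ξ k).2 ≠ (ξ (k + 1)).2)}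

instance (n : ℕ) : TopologicalSpace (TreeBoundary n) :=
  inferInstanceAs (TopologicalSpace {ξ : ℕ → Fin n × Bool //
    ∀ k : ℕ, ¬ ((ξ k).1 = (ξ (k + 1)).1 ∧ (ξ k).2 ≠ (ξ (k + 1)).2)})

/-- The sequence of vertices `g m` of the Cayley tree of `F` with respect to the basis `b`
converges to the boundary point `ξ` in the compactified tree: for every `k`, the `k`-th letter of
the reduced word of `g m` exists and equals the `k`-th letter of `ξ` for all large `m`. -/
def ConvergesToEnd {F : Type*} [Group F] {n : ℕ} (b : FreeGroupBasis (Fin n) F)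
    (g : ℕ → F) (ξ : TreeBoundary n) : Prop :=
  ∀ k : ℕ, ∀ᶠ m in atTop, (b.repr (g m)).toWord[k]? = some (ξ.1 k)

/-- `ξ = g w^∞` and `η = g w^{-∞}` are the two endpoints of a line of the line pattern generated
by `W`, the `w`-line through `g`, for some `w ∈ W` and `g ∈ F`. -/
def IsLineEnds {F : Type*} [Group F] {n : ℕ} (b : FreeGroupBasis (Fin n) F) (W : Set F)
    (ξ η : TreeBoundary n) : Prop :=
  ∃ w ∈ W, ∃ g : F, ConvergesToEnd b (fun m => g * w ^ m) ξ ∧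
    ConvergesToEnd b (fun m => g * w⁻¹ ^ m) η

/-- The decomposition space: the quotient of the boundary of the tree obtained by identifying the
two endpoints of each line of the line pattern generated by `W`. -/
def DecompositionSpace {F : Type*} [Group F] {n : ℕ} (b : FreeGroupBasis (Fin n) F)
    (W : Set F) : Type :=
  Quot (IsLineEnds b W)

/-- The quotient topology. -/
instance {F : Type*} [Group F] {n : ℕ} (b : FreeGroupBasis (Fin n) F) (W : Set F) :
    TopologicalSpace (DecompositionSpace b W) :=
  inferInstanceAs (TopologicalSpace (Quot (IsLineEnds b W)))

/-- A cut set is a set whose complement is not connected (it has a separation into two nonempty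
relatively open pieces). -/
def IsCutSet {X : Type*} [TopologicalSpace X] (S : Set X) : Prop :=
  ¬ IsPreconnected Sᶜ

/-- A cut point is a point that is a cut set. -/
def IsCutPoint {X : Type*} [TopologicalSpace X] (x : X) : Prop :=
  IsCutSet ({x} : Set X)

/-- `{x, y}` is a cut pair: a two point cut set, neither point of which is a cut point. -/
def IsCutPair {X : Type*} [TopologicalSpace X] (x y : X) : Prop :=
  x ≠ y ∧ IsCutSet ({x, y} : Set X) ∧ ¬ IsCutPoint x ∧ ¬ IsCutPoint y

/-- `{x₀, x₁}` crosses `{y₀, y₁}`: the points `x₀` and `x₁` lie in different connected components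
of the complement of `{y₀, y₁}`. -/
def Crosses {X : Type*} [TopologicalSpace X] (x₀ x₁ y₀ y₁ : X) : Prop :=
  x₀ ∈ ({y₀, y₁} : Set X)ᶜ ∧ x₁ ∈ ({y₀, y₁} : Set X)ᶜ ∧
    x₁ ∉ connectedComponentIn ({y₀, y₁} : Set X)ᶜ x₀

/-!
The forward direction is a fact about the circle, where no point and every pair of points cuts.

For the converse, the decomposition space `D` is first shown to be a compact, separable, Hausdorff
and locally connected space. Both nontrivial properties come from one finiteness statement: only
finitely many lines of the pattern have ends that differ in their first `k` letters, since such a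
line passes close to the base vertex (`IsAxis.finite_setOf`). Together with the fact that lines with
one common end have both ends in common (`IsAxis.eq_of_eq`) this makes the identification a closed
equivalence relation, so `D` is Hausdorff. If `D` is connected, the image in `D` of a cylinder of
the boundary, if not all of `D`, has finitely many components, because each of them contains one of
the finitely many points that are identified with a point outside the cylinder: a piece without
such points would be open and closed in `D`. Hence `D` is locally connected
(`locallyConnectedSpace_of_finite_crossingPoints`).

The rest is topology of such a space `X` without cut points
(`nonempty_homeomorph_circle_of_cutPair`). Let `{x, y}` be a cut pair and `A` one side of a
separation of its complement. The points of `A ∪ {x, y}` that separate `x` from `y` there form a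
closed set `E` (`isClosed_cutSet`). A component of `A \ E` would be a gap between two points `s`,
`t` of `E`, and `{s, t}` would be a cut pair. A pair crossing it has one point inside the gap, and
that point separates `x` from `y`, so it belongs to `E`, which is absurd. Hence every point of `A`
separates `x` from `y` (`subset_cutSet`). This gives a linear order on `A`, and comparing a
countable dense subset with the rationals in `(0, 1)` shows that `A ∪ {x, y}` is an arc
(`exists_arc_parametrization`). The two sides give two arcs with common endpoints, that is, a
circle.
-/

open Set Topology

/-! ### Separations by two points -/

/-- `{x, y}ᶜ` is the disjoint union of the nonempty open sets `A` and `B`. -/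
structure IsSeparation {X : Type*} [TopologicalSpace X] (x y : X) (A B : Set X) : Prop where
  ne : x ≠ y
  isOpen_left : IsOpen A
  isOpen_right : IsOpen B
  nonempty_left : A.Nonempty
  nonempty_right : B.Nonempty
  disjoint : Disjoint A B
  union_eq : A ∪ B = {x, y}ᶜ

section Separation

variable {X : Type*} [TopologicalSpace X] {x y u v z a : X} {A B C D : Set X}

/-- An open set whose frontier is at most a non-cut point `z` is trivial. -/
lemma subset_singleton_of_closure_subset_insert {O : Set X} (hz : IsPreconnected ({z}ᶜ : Set X))
    (hO : IsOpen O) (hcl : closure O ⊆ insert z O) (haz : a ≠ z) (ha : a ∉ O) : O ⊆ {z} := by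
  intro w hw
  by_contra hwz
  exact ha (hz.subset_of_closure_inter_subset hO ⟨w, hwz, hw⟩
    (fun t ht => (hcl ht.1).resolve_left ht.2) haz)

namespace IsSeparation

lemma symm (h : IsSeparation x y A B) : IsSeparation x y B A :=
  ⟨h.ne, h.isOpen_right, h.isOpen_left, h.nonempty_right, h.nonempty_left, h.disjoint.symm,
    by rw [union_comm, h.union_eq]⟩

lemma swap (h : IsSeparation x y A B) : IsSeparation y x A B :=
  ⟨h.ne.symm, h.isOpen_left, h.isOpen_right, h.nonempty_left, h.nonempty_right, h.disjoint,
    by rw [pair_comm, h.union_eq]⟩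

lemma mem_or (h : IsSeparation x y A B) (z : X) : z ∈ A ∨ z ∈ B ∨ z = x ∨ z = y := by
  by_cases hz : z ∈ ({x, y}ᶜ : Set X)
  · rw [← h.union_eq] at hz
    exact hz.elim Or.inl (Or.inr ∘ Or.inl)
  · rw [notMem_compl_iff] at hz
    exact Or.inr (Or.inr hz)

lemma left_notMem (h : IsSeparation x y A B) : x ∉ A := fun hx => by
  have : x ∈ ({x, y}ᶜ : Set X) := h.union_eq ▸ Or.inl hx
  simp at this

lemma right_notMem (h : IsSeparation x y A B) : y ∉ A := h.swap.left_notMem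

lemma notMem_of_mem (h : IsSeparation x y A B) (hz : z ∈ A) : z ∉ B :=
  disjoint_left.1 h.disjoint hz

lemma closure_subset (h : IsSeparation x y A B) : closure A ⊆ A ∪ {x, y} := by
  have h1 : closure A ⊆ Bᶜ :=
    closure_minimal (fun z hz => h.notMem_of_mem hz) h.isOpen_right.isClosed_compl
  intro z hz
  rcases h.mem_or z with h2 | h2 | h2
  · exact Or.inl h2
  · exact absurd h2 (h1 hz)
  · exact Or.inr h2

lemma of_closure_subset [T1Space X] (hxy : x ≠ y) (hA : IsOpen A) (hne : A.Nonempty)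
    (hx : x ∉ A) (hy : y ∉ A) (hcl : closure A ⊆ A ∪ {x, y}) (hB : ∃ b, b ∉ A ∧ b ≠ x ∧ b ≠ y) :
    IsSeparation x y A (closure A ∪ {x, y})ᶜ where
  ne := hxy
  isOpen_left := hA
  isOpen_right := (isClosed_closure.union (toFinite _).isClosed).isOpen_compl
  nonempty_left := hne
  nonempty_right := by
    obtain ⟨b, h1, h2, h3⟩ := hB
    refine ⟨b, fun hb => ?_⟩
    rcases hb with hb | hb | hb
    · rcases hcl hb with h | h | h
      exacts [h1 h, h2 h, h3 h]
    · exact h2 hb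
    · exact h3 hb
  disjoint := disjoint_left.2 fun z hz hz' => hz' (Or.inl (subset_closure hz))
  union_eq := by
    ext z
    have h1 := @hcl z
    have h2 := @subset_closure _ _ A z
    simp only [mem_union, mem_compl_iff, mem_insert_iff, mem_singleton_iff] at *
    constructor
    · rintro (h | h) <;> grind
    · grind

variable (hnc : ∀ z : X, IsPreconnected ({z}ᶜ : Set X))
include hnc

lemma left_mem_closure (h : IsSeparation x y A B) : x ∈ closure A := by
  by_contra hx
  have := subset_singleton_of_closure_subset_insert (hnc y) h.isOpen_left
    (fun z hz => by
      rcases h.closure_subset hz with h1 | h1 | h1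
      · exact Or.inr h1
      · exact absurd (h1 ▸ hz) hx
      · exact Or.inl h1) h.ne h.left_notMem
  obtain ⟨w, hw⟩ := h.nonempty_left
  exact h.right_notMem (this hw ▸ hw)

lemma right_mem_closure (h : IsSeparation x y A B) : y ∈ closure A :=
  h.swap.left_mem_closure hnc

/-- A side of a separation together with one of the two points is connected, because otherwise the
other point would be a cut point. -/
lemma isPreconnected_insert (h : IsSeparation x y A B) : IsPreconnected (insert x A) := by
  have key : ∀ u v : Set X, IsOpen u → IsOpen v → insert x A ⊆ u ∪ v →
      insert x A ∩ (u ∩ v) = ∅ → x ∈ u → insert x A ⊆ u := by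
    intro u v hu hv hsub hdis hxu
    have hdis' : ∀ z ∈ insert x A, z ∈ u → z ∉ v := fun z h1 h2 h3 => by
      have : z ∈ insert x A ∩ (u ∩ v) := ⟨h1, h2, h3⟩
      simp [hdis] at this
    by_contra hcon
    obtain ⟨w, hw, hwu⟩ := not_subset.1 hcon
    have hwv : w ∈ v := (hsub hw).resolve_left hwu
    have hwA : w ∈ A := hw.resolve_left (fun h => hwu (h ▸ hxu))
    have hxm := (hnc y).subset_of_closure_inter_subset (hv.inter h.isOpen_left)
      ⟨w, fun h' => h.right_notMem (h' ▸ hwA), hwv, hwA⟩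
      (fun z hz => by
        have hzA : z ∈ insert x A := by
          rcases h.closure_subset (closure_mono inter_subset_right hz.1) with h1 | h1 | h1
          · exact Or.inr h1
          · exact Or.inl h1
          · exact absurd h1 hz.2
        have hzu : z ∉ u := fun hzu => by
          obtain ⟨t, ht, ht'⟩ := mem_closure_iff.1 hz.1 u hu hzu
          exact hdis' t (Or.inr ht'.2) ht ht'.1
        exact ⟨(hsub hzA).resolve_left hzu, hzA.resolve_left fun h => hzu (h ▸ hxu)⟩) h.ne
    exact h.left_notMem hxm.2
  rw [isPreconnected_iff_subset_of_disjoint]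
  intro u v hu hv hsub hdis
  rcases hsub (mem_insert x A) with hx | hx
  · exact Or.inl (key u v hu hv hsub hdis hx)
  · exact Or.inr (key v u hv hu (by rwa [union_comm]) (by rwa [inter_comm v u]) hx)

lemma isPreconnected_union (h : IsSeparation x y A B) : IsPreconnected (A ∪ {x, y}) := by
  have : A ∪ {x, y} = insert x A ∪ insert y A := by
    ext z; simp only [mem_union, mem_insert_iff, mem_singleton_iff]; tauto
  rw [this]
  obtain ⟨w, hw⟩ := h.nonempty_left
  exact (h.isPreconnected_insert hnc).union w (Or.inr hw) (Or.inr hw)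
    (h.swap.isPreconnected_insert hnc)

/-- If `u` and `v` lie on different sides of a separation by `{x, y}`, then `x` and `y` are not on
the same side `C` of a separation by `{u, v}`: each half of the other side `D` would accumulate at
only one of `u` and `v`. -/
lemma notMem_left_of_crossing (h : IsSeparation x y A B) (k : IsSeparation u v C D)
    (hu : u ∈ A) (hv : v ∈ B) : ¬ (x ∈ C ∧ y ∈ C) := by
  rintro ⟨hx, hy⟩
  have key : ∀ {A B : Set X} {u v : X}, IsSeparation x y A B → IsSeparation u v C D →
      u ∈ A → v ∈ B → ∀ d ∈ D, d ∉ A := by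
    intro A B u v h k hu hv d hd hdA
    have hxD : x ∉ D := k.notMem_of_mem hx
    have hyD : y ∉ D := k.notMem_of_mem hy
    have := subset_singleton_of_closure_subset_insert (hnc u)
      (k.isOpen_right.inter h.isOpen_left)
      (fun z hz => by
        have h1 := k.symm.closure_subset (closure_mono inter_subset_left hz)
        have h2 := h.closure_subset (closure_mono inter_subset_right hz)
        have h3 : v ∉ A := h.symm.notMem_of_mem hv
        have h4 : v ≠ x := fun e => h.symm.left_notMem (e ▸ hv)
        have h5 : v ≠ y := fun e => h.symm.right_notMem (e ▸ hv)
        simp only [mem_union, mem_insert_iff, mem_singleton_iff, mem_inter_iff] at *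
        grind) (a := x) (fun e => h.left_notMem (e ▸ hu)) (fun hh => hxD hh.1)
    have hdu : d = u := this ⟨hd, hdA⟩
    exact k.symm.left_notMem (hdu ▸ hd)
  obtain ⟨d, hd⟩ := k.nonempty_right
  rcases h.mem_or d with h1 | h1 | h1 | h1
  · exact key h k hu hv d hd h1
  · exact key h.symm k.swap hv hu d hd h1
  · exact k.notMem_of_mem hx (h1 ▸ hd)
  · exact k.notMem_of_mem hy (h1 ▸ hd)

/-- Crossing is symmetric: if `u` and `v` lie on different sides of a separation by `{x, y}`, then
`x` and `y` lie on different sides of every separation by `{u, v}`. -/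
lemma crossing (h : IsSeparation x y A B) (k : IsSeparation u v C D)
    (hu : u ∈ A) (hv : v ∈ B) : (x ∈ C ∧ y ∈ D) ∨ (x ∈ D ∧ y ∈ C) := by
  have h1 := h.notMem_left_of_crossing hnc k hu hv
  have h2 := h.notMem_left_of_crossing hnc k.symm hu hv
  have hx : x ∈ C ∨ x ∈ D := by
    rcases k.mem_or x with h | h | h' | h'
    · exact Or.inl h
    · exact Or.inr h
    · exact absurd (h' ▸ hu) h.left_notMem
    · exact absurd (h' ▸ hv) h.symm.left_notMem
  have hy : y ∈ C ∨ y ∈ D := by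
    rcases k.mem_or y with h | h | h' | h'
    · exact Or.inl h
    · exact Or.inr h
    · exact absurd (h' ▸ hu) h.right_notMem
    · exact absurd (h' ▸ hv) h.symm.right_notMem
  tauto

/-- The sides of a crossed separation are connected: a second component of `A` together with
`x` and `y` would join `x` to `y` in the complement of `{u, v}`. -/
lemma isPreconnected_of_crossing (h : IsSeparation x y A B) (k : IsSeparation u v C D)
    (hu : u ∈ A) (hv : v ∈ B) : IsPreconnected A := by
  have key : ∀ U V : Set X, IsOpen U → IsOpen V → A ⊆ U ∪ V → A ∩ (U ∩ V) = ∅ → u ∈ U →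
      A ⊆ U := by
    intro U V hU hV hsub hdis huU
    have hdis' : ∀ z ∈ A, z ∈ U → z ∉ V := fun z h1 h2 h3 => by
      have : z ∈ A ∩ (U ∩ V) := ⟨h1, h2, h3⟩
      simp [hdis] at this
    by_contra hcon
    obtain ⟨w, hw, hwu⟩ := not_subset.1 hcon
    have hsep : IsSeparation x y (A ∩ V) ((A ∩ U) ∪ B) :=
      { ne := h.ne
        isOpen_left := h.isOpen_left.inter hV
        isOpen_right := (h.isOpen_left.inter hU).union h.isOpen_right
        nonempty_left := ⟨w, hw, (hsub hw).resolve_left hwu⟩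
        nonempty_right := ⟨u, Or.inl ⟨hu, huU⟩⟩
        disjoint := by
          rw [disjoint_left]
          rintro z ⟨h1, h2⟩ (h3 | h3)
          · exact hdis' z h1 h3.2 h2
          · exact h.notMem_of_mem h1 h3
        union_eq := by
          rw [← h.union_eq]
          ext z
          have := @hsub z
          simp only [mem_union, mem_inter_iff] at *
          tauto }
    have hpre := hsep.isPreconnected_union hnc
    have hsubCD : A ∩ V ∪ {x, y} ⊆ C ∪ D := by
      rw [k.union_eq]
      rintro z hz (e | e)
      · subst e
        rcases hz with hz | hz | hz
        · exact hdis' z hu huU hz.2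
        · exact h.left_notMem (hz ▸ hu)
        · exact h.right_notMem ((mem_singleton_iff.1 hz) ▸ hu)
      · rw [mem_singleton_iff] at e
        subst e
        rcases hz with hz | hz | hz
        · exact h.notMem_of_mem hz.1 hv
        · exact h.symm.left_notMem (hz ▸ hv)
        · exact h.symm.right_notMem ((mem_singleton_iff.1 hz) ▸ hv)
    have hx : x ∈ A ∩ V ∪ {x, y} := by simp
    have hy : y ∈ A ∩ V ∪ {x, y} := by simp
    rcases hpre.subset_or_subset k.isOpen_left k.isOpen_right k.disjoint hsubCD with hC | hC
    · exact h.notMem_left_of_crossing hnc k hu hv ⟨hC hx, hC hy⟩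
    · exact h.notMem_left_of_crossing hnc k.symm hu hv ⟨hC hx, hC hy⟩
  rw [isPreconnected_iff_subset_of_disjoint]
  intro U V hU hV hsub hdis
  rcases hsub hu with hx | hx
  · exact Or.inl (key U V hU hV hsub hdis hx)
  · exact Or.inr (key V U hV hU (by rwa [union_comm]) (by rwa [inter_comm V U]) hx)

end IsSeparation
end Separation

section CutPair

lemma closure_connectedComponentIn_subset {X : Type*} [TopologicalSpace X] (U : Set X)
    (p : X) :
    closure (connectedComponentIn U p) ∩ U ⊆ connectedComponentIn U p := by
  rintro z ⟨hz, hzU⟩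
  by_cases hp : p ∈ U
  · have hpre : IsPreconnected (insert z (connectedComponentIn U p)) :=
      isPreconnected_connectedComponentIn.subset_closure (subset_insert _ _)
        (insert_subset hz subset_closure)
    exact hpre.subset_connectedComponentIn (Or.inr (mem_connectedComponentIn hp))
      (insert_subset hzU (connectedComponentIn_subset _ _)) (mem_insert _ _)
  · rw [connectedComponentIn_eq_empty hp] at hz
    simp at hz

variable {X : Type*} [TopologicalSpace X] {x y u v : X}

lemma IsSeparation.isCutPair {A B : Set X} (h : IsSeparation x y A B)
    (hnc : ∀ z : X, IsPreconnected ({z}ᶜ : Set X)) : IsCutPair x y := by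
  refine ⟨h.ne, fun hp => ?_, fun hc => hc (hnc x), fun hc => hc (hnc y)⟩
  obtain ⟨b, hb⟩ := h.nonempty_right
  obtain ⟨a, ha⟩ := h.nonempty_left
  rcases hp.subset_or_subset h.isOpen_left h.isOpen_right h.disjoint h.union_eq.ge with hs | hs
  · exact h.symm.notMem_of_mem hb (hs (h.union_eq ▸ Or.inr hb))
  · exact h.notMem_of_mem ha (hs (h.union_eq ▸ Or.inl ha))

variable [T1Space X]

lemma IsCutPair.exists_isSeparation (h : IsCutPair x y) : ∃ A B, IsSeparation x y A B := by
  have h1 := h.2.1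
  rw [IsCutSet, isPreconnected_iff_subset_of_disjoint] at h1
  push Not at h1
  obtain ⟨U, V, hU, hV, hsub, hdis, hnU, hnV⟩ := h1
  have hop : IsOpen ({x, y}ᶜ : Set X) := (toFinite _).isClosed.isOpen_compl
  obtain ⟨a, ha, haU⟩ := not_subset.1 hnU
  obtain ⟨b, hb, hbV⟩ := not_subset.1 hnV
  refine ⟨{x, y}ᶜ ∩ U, {x, y}ᶜ ∩ V, h.1, hop.inter hU, hop.inter hV,
    ⟨b, hb, (hsub hb).resolve_right hbV⟩, ⟨a, ha, (hsub ha).resolve_left haU⟩, ?_, ?_⟩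
  · rw [disjoint_left]
    rintro z ⟨h1, h2⟩ ⟨_, h3⟩
    have : z ∈ ({x, y}ᶜ : Set X) ∩ (U ∩ V) := ⟨h1, h2, h3⟩
    simp [hdis] at this
  · rw [← inter_union_distrib_left, inter_eq_left]
    exact hsub

/-- In a locally connected space, points in different components of `{x, y}ᶜ` lie on different sides
of a separation. -/
lemma Crosses.exists_isSeparation [LocallyConnectedSpace X] (hxy : x ≠ y)
    (h : Crosses u v x y) : ∃ A B, IsSeparation x y A B ∧ u ∈ A ∧ v ∈ B := by
  have hop : IsOpen ({x, y}ᶜ : Set X) := (toFinite _).isClosed.isOpen_compl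
  set G := connectedComponentIn ({x, y}ᶜ : Set X) u with hG
  have huG : u ∈ G := mem_connectedComponentIn h.1
  have hGo : IsOpen G := hop.connectedComponentIn
  have hcl : closure G ⊆ G ∪ {x, y} := by
    intro z hz
    by_cases hzc : z ∈ ({x, y}ᶜ : Set X)
    · refine Or.inl ?_
      exact closure_connectedComponentIn_subset _ _ ⟨hz, hzc⟩
    · exact Or.inr (not_not.1 hzc)
  have hGs : G ⊆ {x, y}ᶜ := connectedComponentIn_subset _ _
  have hvx : v ≠ x := fun e => h.2.1 (by simp [e])
  have hvy : v ≠ y := fun e => h.2.1 (by simp [e])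
  refine ⟨G, _, IsSeparation.of_closure_subset hxy hGo ⟨u, huG⟩ (fun hx => hGs hx (by simp))
    (fun hy => hGs hy (by simp)) hcl ⟨v, h.2.2, hvx, hvy⟩, huG, fun hv => ?_⟩
  rcases hv with hv | hv | hv
  · rcases hcl hv with h' | h' | h'
    exacts [h.2.2 h', hvx h', hvy h']
  · exact hvx hv
  · exact hvy hv
end CutPair

/-! ### Points separating the ends of one side of a separation -/

/-- `s` separates `x` from `y` in `A ∪ {x, y}`, where `A` is one side of a separation by `{x, y}`:
the set `A \ {s}` is the disjoint union of open sets `O₁`, `O₂`, of which the first accumulates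
only at `x` and `s`, the second only at `s` and `y`. The degenerate cases `s = x` (with `O₁`
empty) and `s = y` (with `O₂` empty) are allowed. -/
structure IsCutAt {X : Type*} [TopologicalSpace X] (A : Set X) (x y s : X) (O₁ O₂ : Set X) :
    Prop where
  isOpen_left : IsOpen O₁
  isOpen_right : IsOpen O₂
  disjoint : Disjoint O₁ O₂
  union_eq : O₁ ∪ O₂ = A \ {s}
  closure_left : closure O₁ ⊆ O₁ ∪ {x, s}
  closure_right : closure O₂ ⊆ O₂ ∪ {y, s}

/-- The points of `A ∪ {x, y}` that separate `x` from `y` in `A ∪ {x, y}`, and `x`, `y`. -/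
def cutSet {X : Type*} [TopologicalSpace X] (A : Set X) (x y : X) : Set X :=
  {s | s ∈ A ∪ {x, y} ∧ ∃ O₁ O₂, IsCutAt A x y s O₁ O₂}

section Cut

variable {X : Type*} [TopologicalSpace X] {x y u v z a s t : X} {A B C D O₁ O₂ P₁ P₂ : Set X}

namespace IsCutAt

lemma swap (c : IsCutAt A x y s O₁ O₂) : IsCutAt A y x s O₂ O₁ :=
  ⟨c.isOpen_right, c.isOpen_left, c.disjoint.symm, by rw [union_comm, c.union_eq],
    c.closure_right, c.closure_left⟩

lemma left_subset (c : IsCutAt A x y s O₁ O₂) : O₁ ⊆ A := fun z hz =>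
  ((c.union_eq ▸ Or.inl hz : z ∈ A \ {s})).1

lemma right_subset (c : IsCutAt A x y s O₁ O₂) : O₂ ⊆ A := c.swap.left_subset

lemma notMem_left (c : IsCutAt A x y s O₁ O₂) : s ∉ O₁ := fun hz =>
  ((c.union_eq ▸ Or.inl hz : s ∈ A \ {s})).2 rfl

lemma notMem_right (c : IsCutAt A x y s O₁ O₂) : s ∉ O₂ := c.swap.notMem_left

lemma mem_or (c : IsCutAt A x y s O₁ O₂) (hz : z ∈ A) (hs : z ≠ s) : z ∈ O₁ ∨ z ∈ O₂ := by
  have : z ∈ A \ {s} := ⟨hz, hs⟩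
  rwa [← c.union_eq] at this

lemma notMem_of_mem (c : IsCutAt A x y s O₁ O₂) (hz : z ∈ O₁) : z ∉ O₂ :=
  disjoint_left.1 c.disjoint hz

lemma subset_or_subset {G : Set X} (c : IsCutAt A x y s O₁ O₂) (hG : IsPreconnected G)
    (hGA : G ⊆ A) (hs : s ∉ G) : G ⊆ O₁ ∨ G ⊆ O₂ :=
  hG.subset_or_subset c.isOpen_left c.isOpen_right c.disjoint
    fun _ hz => c.mem_or (hGA hz) fun e => hs (e ▸ hz)

variable (hnc : ∀ z : X, IsPreconnected ({z}ᶜ : Set X))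
include hnc

lemma left_eq_empty (c : IsCutAt A x y s O₁ O₂) (h : IsSeparation x y A B) (hs : s = x) :
    O₁ = ∅ := by
  subst hs
  have := subset_singleton_of_closure_subset_insert (hnc s) c.isOpen_left
    (fun z hz => by simpa [or_comm] using c.closure_left hz) h.ne.symm
    (fun hy => h.right_notMem (c.left_subset hy))
  exact eq_empty_of_forall_notMem fun z hz => c.notMem_left (this hz ▸ hz)

variable [T1Space X]

lemma mem_closure_left (c : IsCutAt A x y s O₁ O₂) (h : IsSeparation x y A B) (hs : s ≠ x) :
    s ∈ closure O₁ := by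
  by_contra hcl
  have h1 := subset_singleton_of_closure_subset_insert (hnc x) c.isOpen_left
    (fun z hz => by
      rcases c.closure_left hz with h' | h' | h'
      · exact Or.inr h'
      · exact Or.inl h'
      · exact absurd (mem_singleton_iff.1 h' ▸ hz) hcl) h.ne.symm
    (fun hy => h.right_notMem (c.left_subset hy))
  have h2 : O₁ = ∅ := eq_empty_of_forall_notMem fun z hz =>
    h.left_notMem (c.left_subset (h1 hz ▸ hz))
  have h3 : A ⊆ O₂ ∪ {s} := fun z hz => by
    by_cases hzs : z = s
    · exact Or.inr hzs
    · exact Or.inl ((c.mem_or hz hzs).resolve_left (by simp [h2]))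
  have h4 := closure_mono h3 (h.left_mem_closure hnc)
  rw [closure_union] at h4
  rcases h4 with h4 | h4
  · rcases c.closure_right h4 with h' | h' | h'
    · exact h.left_notMem (c.right_subset h')
    · exact h.ne h'
    · exact hs h'.symm
  · rw [closure_singleton] at h4
    exact hs h4.symm

lemma left_nonempty (c : IsCutAt A x y s O₁ O₂) (h : IsSeparation x y A B) (hs : s ≠ x) :
    O₁.Nonempty :=
  closure_nonempty_iff.1 ⟨s, c.mem_closure_left hnc h hs⟩

lemma right_nonempty (c : IsCutAt A x y s O₁ O₂) (h : IsSeparation x y A B) (hs : s ≠ y) :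
    O₂.Nonempty :=
  c.swap.left_nonempty hnc h.swap hs

lemma left_mem_closure (c : IsCutAt A x y s O₁ O₂) (h : IsSeparation x y A B) (hs : s ≠ x) :
    x ∈ closure O₁ := by
  by_contra hcl
  have hsub := subset_singleton_of_closure_subset_insert (hnc s) c.isOpen_left
    (fun w hw => by
      rcases c.closure_left hw with h3 | h3 | h3
      · exact Or.inr h3
      · exact absurd (h3 ▸ hw) hcl
      · exact Or.inl h3) hs.symm (fun e => h.left_notMem (c.left_subset e))
  obtain ⟨w, hw⟩ := c.left_nonempty hnc h hs
  exact c.notMem_left (hsub hw ▸ hw)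

lemma right_mem_closure (c : IsCutAt A x y s O₁ O₂) (h : IsSeparation x y A B) (hs : s ≠ y) :
    y ∈ closure O₂ :=
  c.swap.left_mem_closure hnc h.swap hs

/-- Two points of the cut set cannot each lie beyond the other. -/
lemma notMem_right_of_mem_right (c : IsCutAt A x y s O₁ O₂) (d : IsCutAt A x y t P₁ P₂)
    (h : IsSeparation x y A B) (ht : t ∈ O₂) : s ∉ P₂ := by
  intro hs
  have hsA := d.right_subset hs
  have htA := c.right_subset ht
  have hx := h.left_notMem
  have hy := h.right_notMem
  have hsx : s ≠ x := fun e => hx (e ▸ hsA)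
  have h1 := subset_singleton_of_closure_subset_insert (hnc s)
    (c.isOpen_left.inter d.isOpen_right) (fun z hz => by
      have h1 := c.closure_left (closure_mono inter_subset_left hz)
      have h2 := d.closure_right (closure_mono inter_subset_right hz)
      have h3 := fun e => c.notMem_of_mem (z := t) e ht
      have h4 := @IsSeparation.ne _ _ _ _ _ _ h
      have h5 := fun e => hx (c.left_subset e)
      have h6 := fun e => hy (c.left_subset e)
      have h7 := fun e => hx (d.right_subset e)
      simp only [mem_union, mem_insert_iff, mem_singleton_iff, mem_inter_iff] at *
      grind) hsx.symm (fun e => hx (c.left_subset e.1))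
  obtain ⟨w, hw⟩ := mem_closure_iff.1 (c.mem_closure_left hnc h hsx) P₂ d.isOpen_right hs
  exact c.notMem_left (h1 hw.symm ▸ hw.2)

lemma notMem_left_of_mem_left (c : IsCutAt A x y s O₁ O₂) (d : IsCutAt A x y t P₁ P₂)
    (h : IsSeparation x y A B) (ht : t ∈ O₁) : s ∉ P₁ :=
  c.swap.notMem_right_of_mem_right hnc d.swap h.swap ht

lemma mem_right_of_mem_left (c : IsCutAt A x y s O₁ O₂) (d : IsCutAt A x y t P₁ P₂)
    (h : IsSeparation x y A B) (hs : s ∈ P₁) (ht : t ∈ A) : t ∈ O₂ :=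
  (c.mem_or ht fun e => d.notMem_left (e ▸ hs)).resolve_left
    fun ht => c.notMem_left_of_mem_left hnc d h ht hs

lemma mem_left_of_mem_right (c : IsCutAt A x y s O₁ O₂) (d : IsCutAt A x y t P₁ P₂)
    (h : IsSeparation x y A B) (hs : s ∈ P₂) (ht : t ∈ A) : t ∈ O₁ :=
  c.swap.mem_right_of_mem_left hnc d.swap h.swap hs ht

lemma left_subset_left (c : IsCutAt A x y s O₁ O₂) (d : IsCutAt A x y t P₁ P₂)
    (h : IsSeparation x y A B) (hs : s ∈ P₁) (ht : t ∈ A) : O₁ ⊆ P₁ := by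
  have htO := c.mem_right_of_mem_left hnc d h hs ht
  have hx := h.left_notMem
  have hy := h.right_notMem
  have hsA := d.left_subset hs
  have hsx : s ≠ x := fun e => hx (e ▸ hsA)
  have h1 := subset_singleton_of_closure_subset_insert (hnc s)
    (c.isOpen_left.inter d.isOpen_right) (fun z hz => by
      have h1 := c.closure_left (closure_mono inter_subset_left hz)
      have h2 := d.closure_right (closure_mono inter_subset_right hz)
      have h3 := fun e => c.notMem_of_mem (z := t) e htO
      have h4 := h.ne
      have h5 := fun e => hx (c.left_subset e)
      have h6 := fun e => hy (c.left_subset e)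
      have h7 := fun e => hx (d.right_subset e)
      simp only [mem_union, mem_insert_iff, mem_singleton_iff, mem_inter_iff] at *
      grind) hsx.symm (fun e => hx (c.left_subset e.1))
  intro z hz
  refine (d.mem_or (c.left_subset hz) fun e => ?_).resolve_right fun hz' => ?_
  · exact c.notMem_of_mem hz (e ▸ htO)
  · exact c.notMem_left (h1 ⟨hz, hz'⟩ ▸ hz)

end IsCutAt

lemma cutSet_swap (A : Set X) (x y : X) : cutSet A x y = cutSet A y x := by
  ext s
  simp only [cutSet, mem_ofPred_eq, pair_comm x y]
  exact and_congr_right fun _ =>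
    ⟨fun ⟨O₁, O₂, c⟩ => ⟨O₂, O₁, c.swap⟩, fun ⟨O₁, O₂, c⟩ => ⟨O₂, O₁, c.swap⟩⟩

lemma left_mem_cutSet (h : IsSeparation x y A B) : x ∈ cutSet A x y := by
  refine ⟨by simp, ∅, A, isOpen_empty, h.isOpen_left, empty_disjoint _, ?_, by simp, ?_⟩
  · rw [empty_union, sdiff_singleton_eq_self h.left_notMem]
  · rw [pair_comm]; exact h.closure_subset

lemma right_mem_cutSet (h : IsSeparation x y A B) : y ∈ cutSet A x y :=
  cutSet_swap A y x ▸ left_mem_cutSet h.swap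

section Limit

variable [T2Space X] [LocallyConnectedSpace X] {p : X} {𝒰 : Ultrafilter X} {Q₁ Q₂ : X → Set X}

/-- The limit of the sides `Q₁ e`, as the separating points `e` converge to `p`, is open: a
connected neighbourhood of a point `z ≠ p` that stays away from `p` lies on one side of `e` for `e`
near `p`. -/
lemma isOpen_limit (hA : IsOpen A) (hp : (𝒰 : Filter X) ≤ 𝓝 p)
    (hQ : ∀ᶠ e in 𝒰, IsCutAt A x y e (Q₁ e) (Q₂ e)) :
    IsOpen {z | z ∈ A ∧ z ≠ p ∧ ∀ᶠ e in 𝒰, z ∈ Q₁ e} := by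
  rw [isOpen_iff_mem_nhds]
  rintro z ⟨hzA, hzp, hz⟩
  obtain ⟨U, U', hU, hU', hzU, hpU', hd⟩ := t2_separation hzp
  have hV : IsOpen (connectedComponentIn (U ∩ A) z) := (hU.inter hA).connectedComponentIn
  have hzV : z ∈ connectedComponentIn (U ∩ A) z := mem_connectedComponentIn ⟨hzU, hzA⟩
  have hVs : connectedComponentIn (U ∩ A) z ⊆ U ∩ A := connectedComponentIn_subset _ _
  refine mem_of_superset (hV.mem_nhds hzV) fun w hw => ⟨(hVs hw).2, fun e => ?_, ?_⟩
  · exact disjoint_left.1 hd (hVs hw).1 (e ▸ hpU')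
  · filter_upwards [hz, hQ, hp (hU'.mem_nhds hpU')] with e h1 h2 h3
    rcases h2.subset_or_subset isPreconnected_connectedComponentIn (hVs.trans inter_subset_right)
      (fun he => disjoint_left.1 hd (hVs he).1 h3) with h | h
    · exact h hw
    · exact absurd (h hzV) (h2.notMem_of_mem h1)

/-- The limit of the sides `Q₁ e`, as the separating points `e` converge to `p`, accumulates only at
`x` and `p`. -/
lemma closure_limit (hp : (𝒰 : Filter X) ≤ 𝓝 p)
    (hQ : ∀ᶠ e in 𝒰, IsCutAt A x y e (Q₁ e) (Q₂ e)) :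
    closure {z | z ∈ A ∧ z ≠ p ∧ ∀ᶠ e in 𝒰, z ∈ Q₁ e} ⊆
      {z | z ∈ A ∧ z ≠ p ∧ ∀ᶠ e in 𝒰, z ∈ Q₁ e} ∪ {x, p} := by
  intro w hw
  by_contra hcon
  simp only [mem_union, mem_insert_iff, mem_singleton_iff, not_or] at hcon
  obtain ⟨hw1, hwx, hwp⟩ := hcon
  obtain ⟨U, U', hU, hU', hzU, hpU', hd⟩ := t2_separation hwp
  have hV : IsOpen (connectedComponentIn (U ∩ {x}ᶜ) w) :=
    (hU.inter isOpen_compl_singleton).connectedComponentIn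
  have hwV : w ∈ connectedComponentIn (U ∩ {x}ᶜ) w := mem_connectedComponentIn ⟨hzU, hwx⟩
  have hVs : connectedComponentIn (U ∩ {x}ᶜ) w ⊆ U ∩ {x}ᶜ := connectedComponentIn_subset _ _
  obtain ⟨z, hzV, hzA, hzp, hz⟩ := mem_closure_iff.1 hw _ hV hwV
  have key : ∀ᶠ e in 𝒰, w ∈ Q₁ e ∧ w ∈ A := by
    filter_upwards [hz, hQ, hp (hU'.mem_nhds hpU')] with e h1 h2 h3
    have := isPreconnected_connectedComponentIn.subset_of_closure_inter_subset h2.isOpen_left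
      ⟨z, hzV, h1⟩ (fun t ht => by
        rcases h2.closure_left ht.1 with h | h | h
        · exact h
        · exact absurd h (hVs ht.2).2
        · exact absurd h3 (disjoint_left.1 hd (mem_singleton_iff.1 h ▸ (hVs ht.2).1)))
    exact ⟨this hwV, h2.left_subset (this hwV)⟩
  obtain ⟨e, he⟩ := key.exists
  exact hw1 ⟨he.2, hwp, key.mono fun _ h => h.1⟩

/-- The cut set is closed: along an ultrafilter of separating points, the sides converge, and local
connectedness keeps the limits open. -/
lemma isClosed_cutSet (h : IsSeparation x y A B) : IsClosed (cutSet A x y) := by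
  rw [isClosed_iff_ultrafilter]
  intro p 𝒰 hp hE
  have hpA : p ∈ A ∪ {x, y} := by
    have hcl : closure (A ∪ {x, y}) = A ∪ {x, y} := by
      refine subset_antisymm ?_ subset_closure
      rw [closure_union, (toFinite ({x, y} : Set X)).isClosed.closure_eq]
      exact union_subset h.closure_subset subset_union_right
    rw [← hcl, mem_closure_iff_ultrafilter]
    exact ⟨𝒰, mem_of_superset hE fun z hz => hz.1, hp⟩
  have hE' : ∀ e ∈ cutSet A x y, ∃ O₁ O₂, IsCutAt A x y e O₁ O₂ := fun e he => he.2
  choose! Q₁ Q₂ hQ using hE'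
  have hQ' : ∀ᶠ e in 𝒰, IsCutAt A x y e (Q₁ e) (Q₂ e) := mem_of_superset hE hQ
  have hQs : ∀ᶠ e in 𝒰, IsCutAt A y x e (Q₂ e) (Q₁ e) := hQ'.mono fun _ h => h.swap
  refine ⟨hpA, _, _, isOpen_limit h.isOpen_left hp hQ', isOpen_limit h.isOpen_left hp hQs, ?_, ?_,
    closure_limit hp hQ', closure_limit hp hQs⟩
  · rw [disjoint_left]
    rintro z ⟨_, _, h1⟩ ⟨_, _, h2⟩
    obtain ⟨e, h1, h2, h3⟩ := (h1.and (h2.and hQ')).exists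
    exact h3.notMem_of_mem h1 h2
  · ext z
    constructor
    · rintro (h | h) <;> exact ⟨h.1, h.2.1⟩
    · rintro ⟨hzA, hzp⟩
      have : ∀ᶠ e in 𝒰, z ∈ Q₁ e ∨ z ∈ Q₂ e := by
        filter_upwards [hQ', hp (isOpen_ne.mem_nhds (Ne.symm hzp))] with e h1 h2
        exact h1.mem_or hzA (Ne.symm h2)
      rcases Ultrafilter.eventually_or.1 this with h | h
      · exact Or.inl ⟨hzA, hzp, h⟩
      · exact Or.inr ⟨hzA, hzp, h⟩

end Limit

end Cut

/-! ### Crossed cut pairs leave no gaps -/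

section Gap

variable {X : Type*} [TopologicalSpace X] {x y u v s t p : X} {A B C D G N : Set X}
  {O₁ O₂ P₁ P₂ : Set X}

variable (hnc : ∀ z : X, IsPreconnected ({z}ᶜ : Set X))
include hnc

variable [T1Space X]

/-- If `G` is the gap of the cut set between `s` and `t`, and a pair `{u, v}` crosses `{s, t}` with
`u ∈ G`, then `u` separates `x` from `y`, too. -/
lemma mem_cutSet_of_crossing (h : IsSeparation x y A B) (c : IsCutAt A x y s O₁ O₂)
    (d : IsCutAt A x y t P₁ P₂) (hs : s ∈ A ∪ {x, y}) (ht : t ∈ A ∪ {x, y})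
    (g : IsSeparation s t G N) (hGO : G ⊆ O₂) (hGP : G ⊆ P₁) (k : IsSeparation u v C D)
    (hu : u ∈ G) (hv : v ∈ N) (hsC : s ∈ C) (htD : t ∈ D) : u ∈ cutSet A x y := by
  have hxA := h.left_notMem
  have hyA := h.right_notMem
  have hxy := h.ne
  have hst := g.ne
  have hGA : G ⊆ A := hGO.trans c.right_subset
  have hN : IsPreconnected N := g.symm.isPreconnected_of_crossing hnc k.swap hv hu
  have hsy : s ≠ y := fun e => by
    have := c.swap.left_eq_empty hnc h.swap e
    simpa [this] using hGO hu
  have htx : t ≠ x := fun e => by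
    have := d.left_eq_empty hnc h e
    simpa [this] using hGP hu
  have hsO := c.notMem_right
  have htP := d.notMem_left
  -- the connected set `N` contains `B`, so it has no room for another part between `s` and `t`
  have hH : O₂ ∩ P₁ ⊆ G := by
    intro z hz
    rcases g.mem_or z with h1 | h1 | h1 | h1
    · exact h1
    · exfalso
      have hsub : N ⊆ O₂ ∩ P₁ := hN.subset_of_closure_inter_subset
        (c.isOpen_right.inter d.isOpen_left) ⟨z, h1, hz⟩ (fun w hw => by
          have h2 := c.closure_right (closure_mono inter_subset_left hw.1)
          have h3 := d.closure_left (closure_mono inter_subset_right hw.1)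
          have h4 : w ≠ s := fun e => g.symm.left_notMem (e ▸ hw.2)
          have h5 : w ≠ t := fun e => g.symm.right_notMem (e ▸ hw.2)
          have h6 := fun e => hxA (c.right_subset e)
          have h7 := fun e => hyA (d.left_subset e)
          simp only [mem_union, mem_insert_iff, mem_singleton_iff, mem_inter_iff] at *
          grind)
      obtain ⟨b, hb⟩ := h.nonempty_right
      have hbA := h.symm.notMem_of_mem hb
      have hbN : b ∈ N := by
        rcases g.mem_or b with h2 | h2 | h2 | h2
        · exact absurd (hGA h2) hbA
        · exact h2
        · rcases hs with h3 | h3 | h3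
          · exact absurd (h2 ▸ h3) hbA
          · exact absurd hb (h2 ▸ h3 ▸ h.symm.left_notMem)
          · exact absurd h3 hsy
        · rcases ht with h3 | h3 | h3
          · exact absurd (h2 ▸ h3) hbA
          · exact absurd h3 htx
          · exact absurd hb (h2 ▸ (mem_singleton_iff.1 h3) ▸ h.symm.right_notMem)
      exact hbA (c.right_subset (hsub hbN).1)
    · exact absurd hz.1 (h1 ▸ hsO)
    · exact absurd hz.2 (h1 ▸ htP)
  have htO : t ∈ O₂ ∨ t = y := by
    rcases c.closure_right (closure_mono hGO (g.right_mem_closure hnc)) with h1 | h1 | h1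
    exacts [Or.inl h1, Or.inr h1, absurd h1 hst.symm]
  have hsP : s ∈ P₁ ∨ s = x := by
    rcases d.closure_left (closure_mono hGP (g.left_mem_closure hnc)) with h1 | h1 | h1
    exacts [Or.inl h1, Or.inr h1, absurd h1 hst]
  have hdisj : ∀ z ∈ O₁, z ∉ P₂ := by
    intro z hz hz'
    rcases htO with h1 | h1
    · rcases hsP with h2 | h2
      · exact d.notMem_of_mem (c.left_subset_left hnc d h h2 (c.right_subset h1) hz) hz'
      · simp [c.left_eq_empty hnc h h2] at hz
    · simp [d.swap.left_eq_empty hnc h.swap h1] at hz'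
  have hOG : ∀ z ∈ O₁, z ∉ G := fun z hz hzG => c.notMem_of_mem hz (hGO hzG)
  have hPG : ∀ z ∈ P₂, z ∉ G := fun z hz hzG => d.notMem_of_mem (hGP hzG) hz
  have hsP2 : s ∉ P₂ := fun e => by
    rcases hsP with h1 | h1
    · exact d.notMem_of_mem h1 e
    · exact hxA (h1 ▸ d.right_subset e)
  have htO1 : t ∉ O₁ := fun e => by
    rcases htO with h1 | h1
    · exact c.notMem_of_mem e h1
    · exact hyA (h1 ▸ c.left_subset e)
  have hsG := g.left_notMem
  have htG := g.right_notMem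
  have huC := k.left_notMem
  have huD := k.symm.left_notMem
  have hvG := g.symm.notMem_of_mem hv
  have hCD : ∀ z ∈ C, z ∉ D := fun z hz => k.notMem_of_mem hz
  have hsA : s ∈ A ∨ s = x := by
    rcases hs with h1 | h1 | h1
    exacts [Or.inl h1, Or.inr h1, absurd h1 hsy]
  have htA : t ∈ A ∨ t = y := by
    rcases ht with h1 | h1 | h1
    exacts [Or.inl h1, absurd h1 htx, Or.inr h1]
  have huA := hGA hu
  have hOA := c.left_subset
  have hPA := d.right_subset
  have huO1 : u ∉ O₁ := fun e => hOG u e hu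
  have huP2 : u ∉ P₂ := fun e => hPG u e hu
  have hvs : v ≠ s := fun e => g.symm.left_notMem (e ▸ hv)
  have hvt : v ≠ t := fun e => g.symm.right_notMem (e ▸ hv)
  -- the parts of `A` before and after `u`; the points `s` and `t` belong to them unless `s = x`
  -- or `t = y`
  set Q₁ : Set X := O₁ ∪ (A ∩ {s}) ∪ (G ∩ C) with hQ₁
  set Q₂ : Set X := P₂ ∪ (A ∩ {t}) ∪ (G ∩ D) with hQ₂
  have hQd : ∀ z ∈ Q₁, z ∉ Q₂ := by
    intro z
    have h1 := hdisj z
    have h2 := hCD z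
    have h3 := hOG z
    have h4 := hPG z
    simp only [hQ₁, hQ₂, mem_union, mem_inter_iff, mem_singleton_iff]
    grind
  have hQu : Q₁ ∪ Q₂ = A \ {u} := by
    ext z
    have h1 : z ∈ A → z ≠ s → z ∈ O₁ ∨ z ∈ O₂ := c.mem_or
    have h2 : z ∈ A → z ≠ t → z ∈ P₁ ∨ z ∈ P₂ := d.mem_or
    have h3 := @hH z
    have h4 := k.mem_or z
    have h5 := @hGA z
    have h6 := @hOA z
    have h7 := @hPA z
    simp only [hQ₁, hQ₂, mem_union, mem_inter_iff, mem_singleton_iff, Set.mem_sdiff] at *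
    grind
  have hcl1 : closure Q₁ ⊆ Q₁ ∪ {x, u} := by
    intro z hz
    rw [hQ₁, closure_union, closure_union] at hz
    rcases hz with (hz | hz) | hz
    · have h1 := c.closure_left hz
      simp only [hQ₁, mem_union, mem_inter_iff, mem_singleton_iff, mem_insert_iff] at *
      grind
    · have h1 := closure_mono inter_subset_right hz
      rw [closure_singleton] at h1
      simp only [hQ₁, mem_union, mem_inter_iff, mem_singleton_iff, mem_insert_iff] at *
      grind
    · have h1 := g.closure_subset (closure_mono inter_subset_left hz)
      have h2 := k.closure_subset (closure_mono inter_subset_right hz)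
      have h3 := hCD t
      simp only [hQ₁, mem_union, mem_inter_iff, mem_singleton_iff, mem_insert_iff] at *
      grind
  have hcl2 : closure Q₂ ⊆ Q₂ ∪ {y, u} := by
    intro z hz
    rw [hQ₂, closure_union, closure_union] at hz
    rcases hz with (hz | hz) | hz
    · have h1 := d.closure_right hz
      simp only [hQ₂, mem_union, mem_inter_iff, mem_singleton_iff, mem_insert_iff] at *
      grind
    · have h1 := closure_mono inter_subset_right hz
      rw [closure_singleton] at h1
      simp only [hQ₂, mem_union, mem_inter_iff, mem_singleton_iff, mem_insert_iff] at *
      grind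
    · have h1 := g.closure_subset (closure_mono inter_subset_left hz)
      have h2 := k.symm.closure_subset (closure_mono inter_subset_right hz)
      have h3 := hCD s
      simp only [hQ₂, mem_union, mem_inter_iff, mem_singleton_iff, mem_insert_iff] at *
      grind
  have hop : ∀ {Q Q' : Set X} {w : X}, (∀ z ∈ Q, z ∉ Q') → Q ∪ Q' = A \ {u} → w ∉ A →
      closure Q' ⊆ Q' ∪ {w, u} → IsOpen Q := by
    intro Q Q' w h1 h2 h3 h4
    have : Q = A ∩ (closure Q' ∪ {u})ᶜ := by
      ext z
      have h5 : z ∈ Q ∪ Q' ↔ z ∈ A \ {u} := by rw [h2]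
      have h6 := h1 z
      have h7 := @h4 z
      have h8 := @subset_closure _ _ Q' z
      have h9 : z = w → z ∉ A := fun e => e ▸ h3
      simp only [mem_union, mem_inter_iff, mem_singleton_iff, mem_insert_iff, mem_compl_iff,
        Set.mem_sdiff] at *
      grind
    rw [this]
    exact h.isOpen_left.inter (isClosed_closure.union isClosed_singleton).isOpen_compl
  exact ⟨Or.inl huA, Q₁, Q₂, hop hQd hQu hyA hcl2,
    hop (fun z h1 h2 => hQd z h2 h1) (by rw [union_comm, hQu]) hxA hcl1,
    disjoint_left.2 hQd, hQu, hcl1, hcl2⟩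

variable [T2Space X] [LocallyConnectedSpace X]

/-- If every cut pair is crossed, each point of a side of a separation by `{x, y}` separates `x`
from `y` there. A component of the complement of the cut set is a gap bounded by two points, which
form a cut pair; a pair crossing it would put a point of the cut set inside the gap. -/
lemma subset_cutSet (h : IsSeparation x y A B)
    (hcross : ∀ s t : X, IsCutPair s t → ∃ u v, IsCutPair u v ∧ Crosses u v s t) :
    A ⊆ cutSet A x y := by
  intro p hpA
  by_contra hp
  have hxE := left_mem_cutSet h
  have hyE := right_mem_cutSet h
  have hop : IsOpen (A \ cutSet A x y) := h.isOpen_left.sdiff (isClosed_cutSet h)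
  set E := cutSet A x y with hE
  set G := connectedComponentIn (A \ E) p with hG
  have hpG : p ∈ G := mem_connectedComponentIn ⟨hpA, hp⟩
  have hGo : IsOpen G := hop.connectedComponentIn
  have hGpre : IsPreconnected G := isPreconnected_connectedComponentIn
  have hGs : G ⊆ A \ E := connectedComponentIn_subset _ _
  have hGA : G ⊆ A := hGs.trans sdiff_subset
  have hGE : ∀ z ∈ G, z ∉ E := fun z hz => (hGs hz).2
  have hGcl : ∀ z ∈ closure G, z ∈ G ∨ z ∈ E := by
    intro z hz
    by_cases hzE : z ∈ E
    · exact Or.inr hzE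
    · refine Or.inl (closure_connectedComponentIn_subset _ _ ⟨hz, ?_, hzE⟩)
      rcases h.closure_subset (closure_mono hGA hz) with h1 | h1 | h1
      · exact h1
      · exact absurd (h1 ▸ hxE) hzE
      · exact absurd (mem_singleton_iff.1 h1 ▸ hyE) hzE
  have hE' : ∀ e ∈ E, ∃ O₁ O₂, IsCutAt A x y e O₁ O₂ := fun e he => he.2
  choose! Q₁ Q₂ hQ using hE'
  have hor : ∀ s ∈ E, G ⊆ Q₁ s ∨ G ⊆ Q₂ s := fun s hs =>
    (hQ s hs).subset_or_subset hGpre hGA fun hsG => hGE s hsG hs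
  have hnot : ∀ s ∈ E, G ⊆ Q₁ s → ¬ G ⊆ Q₂ s := fun s hs h1 h2 =>
    (hQ s hs).notMem_of_mem (h1 hpG) (h2 hpG)
  have huniq2 : ∀ s ∈ E, ∀ t ∈ E, s ∈ closure G → t ∈ closure G → G ⊆ Q₂ s → G ⊆ Q₂ t →
      s = t := by
    intro s hs t ht hsG htG h1 h2
    by_contra hst
    have key : ∀ s ∈ E, ∀ t ∈ E, t ∈ closure G → G ⊆ Q₂ s → G ⊆ Q₂ t → s ≠ t → t ∈ Q₂ s := by
      intro s hs t ht htG h1 h2 hst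
      rcases (hQ s hs).closure_right (closure_mono h1 htG) with h3 | h3 | h3
      · exact h3
      · have := (hQ t ht).swap.left_eq_empty hnc h.swap h3
        simpa [this] using h2 hpG
      · exact absurd h3 (Ne.symm hst)
    exact (hQ s hs).notMem_right_of_mem_right hnc (hQ t ht) h (key s hs t ht htG h1 h2 hst)
      (key t ht s hs hsG h2 h1 (Ne.symm hst))
  have huniq1 : ∀ s ∈ E, ∀ t ∈ E, s ∈ closure G → t ∈ closure G → G ⊆ Q₁ s → G ⊆ Q₁ t →
      s = t := by
    intro s hs t ht hsG htG h1 h2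
    by_contra hst
    have key : ∀ s ∈ E, ∀ t ∈ E, t ∈ closure G → G ⊆ Q₁ s → G ⊆ Q₁ t → s ≠ t → t ∈ Q₁ s := by
      intro s hs t ht htG h1 h2 hst
      rcases (hQ s hs).closure_left (closure_mono h1 htG) with h3 | h3 | h3
      · exact h3
      · have := (hQ t ht).left_eq_empty hnc h h3
        simpa [this] using h2 hpG
      · exact absurd h3 (Ne.symm hst)
    exact (hQ s hs).notMem_left_of_mem_left hnc (hQ t ht) h (key s hs t ht htG h1 h2 hst)
      (key t ht s hs hsG h2 h1 (Ne.symm hst))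
  -- the frontier of `G` is not a single point, as there are no cut points
  have hfr : ∀ t, ¬ closure G ⊆ insert t G := by
    intro t ht
    have : G ⊆ {t} := by
      by_cases hxt : x = t
      · exact subset_singleton_of_closure_subset_insert (hnc t) hGo ht (a := y)
          (fun e => h.ne (hxt.trans e.symm)) (fun e => hGE y e hyE)
      · exact subset_singleton_of_closure_subset_insert (hnc t) hGo ht hxt
          (fun e => hGE x e hxE)
    have hGp : G = {p} := subset_antisymm (fun z hz => by
      rw [mem_singleton_iff, mem_singleton_iff.1 (this hz), mem_singleton_iff.1 (this hpG)])
      (by simpa using hpG)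
    have := subset_singleton_of_closure_subset_insert (hnc x) hGo
      (by rw [hGp, closure_singleton]; exact subset_insert _ _) h.ne.symm (fun e => hGE y e hyE)
    exact hp (mem_singleton_iff.1 (this hpG) ▸ hxE)
  have hex : ∀ P : X → Prop, (∀ s ∈ E, ∀ t ∈ E, s ∈ closure G → t ∈ closure G → P s → P t →
      s = t) → ∃ s ∈ E, s ∈ closure G ∧ ¬ P s := by
    intro P hP
    by_contra! hcon
    by_cases hne : ∃ t ∈ E, t ∈ closure G
    · obtain ⟨t, ht, htG⟩ := hne
      refine hfr t fun z hz => ?_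
      rcases hGcl z hz with h1 | h1
      · exact Or.inr h1
      · exact Or.inl (hP z h1 t ht hz htG (hcon z h1 hz) (hcon t ht htG))
    · push Not at hne
      exact hfr x fun z hz => Or.inr ((hGcl z hz).resolve_right fun h1 => hne z h1 hz)
  obtain ⟨s, hsE, hsG, hs1⟩ := hex (fun s => G ⊆ Q₁ s) huniq1
  obtain ⟨t, htE, htG, ht2⟩ := hex (fun s => G ⊆ Q₂ s) huniq2
  have hs2 : G ⊆ Q₂ s := (hor s hsE).resolve_left hs1
  have ht1 : G ⊆ Q₁ t := (hor t htE).resolve_right ht2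
  have hst : s ≠ t := fun e => hs1 (e ▸ ht1)
  have hcl : closure G ⊆ G ∪ {s, t} := by
    intro z hz
    rcases hGcl z hz with h1 | h1
    · exact Or.inl h1
    · rcases hor z h1 with h2 | h2
      · exact Or.inr (Or.inr (huniq1 z h1 t htE hz htG h2 ht1))
      · exact Or.inr (Or.inl (huniq2 z h1 s hsE hz hsG h2 hs2))
  have hEB : ∀ e ∈ E, ∀ b ∈ B, b ≠ e := by
    rintro e ⟨h1 | h1 | h1, -⟩ b hb hbe
    · exact h.symm.notMem_of_mem hb (hbe ▸ h1)
    · exact h.symm.left_notMem (h1 ▸ hbe ▸ hb)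
    · exact h.symm.right_notMem (mem_singleton_iff.1 h1 ▸ hbe ▸ hb)
  obtain ⟨b, hb⟩ := h.nonempty_right
  have g := IsSeparation.of_closure_subset hst hGo ⟨p, hpG⟩ (fun e => hGE s e hsE)
    (fun e => hGE t e htE) hcl
    ⟨b, fun e => h.symm.notMem_of_mem hb (hGA e), hEB s hsE b hb, hEB t htE b hb⟩
  obtain ⟨u, v, huv, hcr⟩ := hcross s t (g.isCutPair hnc)
  obtain ⟨A', B', g', hu, hv⟩ := hcr.exists_isSeparation hst
  obtain ⟨C, D, k⟩ := huv.exists_isSeparation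
  have main : ∀ {A' B' C D : Set X} {u v : X}, IsSeparation s t A' B' → u ∈ A' → v ∈ B' →
      IsSeparation u v C D → G ⊆ A' → False := by
    intro A' B' C D u v g' hu hv k hGA'
    have hA' : A' ⊆ G := by
      refine (g'.isPreconnected_of_crossing hnc k hu hv).subset_of_closure_inter_subset hGo
        ⟨p, hGA' hpG, hpG⟩ fun z hz => ?_
      rcases hcl hz.1 with h1 | h1 | h1
      · exact h1
      · exact absurd (h1 ▸ hz.2) g'.left_notMem
      · exact absurd (mem_singleton_iff.1 h1 ▸ hz.2) g'.right_notMem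
    have huG := hA' hu
    have hvN : v ∈ (closure G ∪ {s, t})ᶜ := by
      rcases g.mem_or v with h1 | h1 | h1 | h1
      · exact absurd hv (g'.notMem_of_mem (hGA' h1))
      · exact h1
      · exact absurd (h1 ▸ hv) g'.symm.left_notMem
      · exact absurd (h1 ▸ hv) g'.symm.right_notMem
    rcases g.crossing hnc k huG hvN with ⟨h1, h2⟩ | ⟨h1, h2⟩
    · exact hGE u huG (mem_cutSet_of_crossing hnc h (hQ s hsE) (hQ t htE) hsE.1 htE.1 g hs2 ht1 k
        huG hvN h1 h2)
    · exact hGE u huG (mem_cutSet_of_crossing hnc h (hQ s hsE) (hQ t htE) hsE.1 htE.1 g hs2 ht1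
        k.symm huG hvN h1 h2)
  have hGsub : G ⊆ A' ∪ B' := by
    rw [g'.union_eq, ← g.union_eq]
    exact subset_union_left
  rcases hGpre.subset_or_subset g'.isOpen_left g'.isOpen_right g'.disjoint hGsub with h1 | h1
  · exact main g' hu hv k h1
  · exact main g'.symm hv hu k.swap h1

end Gap

/-! ### The sides of a cut pair are arcs -/

section Arc

variable {X : Type*} [TopologicalSpace X] [T1Space X] {x y : X} {A B : Set X}
  {Q₁ Q₂ : X → Set X}

/-- A side `A` of a separation all of whose points separate `x` from `y` carries the linear order
`a < b ↔ a ∈ Q₁ b`. By Cantor's theorem a countable dense subset is order isomorphic to the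
rationals in `(0, 1)`. -/
lemma exists_dense_orderIso [TopologicalSpace.SeparableSpace X]
    (hnc : ∀ z : X, IsPreconnected ({z}ᶜ : Set X))
    (h : IsSeparation x y A B) (hQ : ∀ s ∈ A, IsCutAt A x y s (Q₁ s) (Q₂ s)) :
    ∃ (D : Set X) (φ : X → ℝ), D ⊆ A ∧ (∀ U : Set X, IsOpen U → U.Nonempty → U ⊆ A →
      (U ∩ D).Nonempty) ∧ (∀ a ∈ D, ∀ b ∈ D, a ∈ Q₁ b ↔ φ a < φ b) ∧
      (∀ a ∈ D, 0 < φ a ∧ φ a < 1) ∧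
      ∀ r r' : ℝ, 0 ≤ r → r < r' → r' ≤ 1 → ∃ d ∈ D, r < φ d ∧ φ d < r' := by
  classical
  obtain ⟨S, hSc, hSd⟩ := TopologicalSpace.exists_countable_dense X
  set D : Set X := S ∩ A with hD
  have hDA : D ⊆ A := inter_subset_right
  have hdense : ∀ U : Set X, IsOpen U → U.Nonempty → U ⊆ A → (U ∩ D).Nonempty := by
    intro U hU hne hUA
    obtain ⟨d, hd, hdS⟩ := hSd.inter_open_nonempty U hU hne
    exact ⟨d, hd, hdS, hUA hd⟩
  have hx : ∀ a ∈ A, a ≠ x := fun a ha e => h.left_notMem (e ▸ ha)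
  have hy : ∀ a ∈ A, a ≠ y := fun a ha e => h.right_notMem (e ▸ ha)
  have hto : ∀ a b : D, a.1 ∈ Q₁ b.1 → b.1 ∈ Q₂ a.1 := fun a b hab =>
    (hQ a (hDA a.2)).mem_right_of_mem_left hnc (hQ b (hDA b.2)) h hab (hDA b.2)
  have hfrom : ∀ a b : D, a.1 ∈ Q₂ b.1 → b.1 ∈ Q₁ a.1 := fun a b hab =>
    (hQ a (hDA a.2)).mem_left_of_mem_right hnc (hQ b (hDA b.2)) h hab (hDA b.2)
  have hirr : ∀ a : D, a.1 ∉ Q₁ a.1 := fun a => (hQ a (hDA a.2)).notMem_left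
  have htrans : ∀ a b c : D, a.1 ∈ Q₁ b.1 → b.1 ∈ Q₁ c.1 → a.1 ∈ Q₁ c.1 := fun a b c hab hbc =>
    (hQ b (hDA b.2)).left_subset_left hnc (hQ c (hDA c.2)) h hbc (hDA c.2) hab
  let : LinearOrder D :=
    { le := fun a b => a = b ∨ a.1 ∈ Q₁ b.1
      lt := fun a b => a.1 ∈ Q₁ b.1
      le_refl := fun a => Or.inl rfl
      le_trans := by
        rintro a b c (rfl | hab) (rfl | hbc)
        · exact Or.inl rfl
        · exact Or.inr hbc
        · exact Or.inr hab
        · exact Or.inr (htrans a b c hab hbc)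
      lt_iff_le_not_ge := by
        intro a b
        refine ⟨fun hab => ⟨Or.inr hab, ?_⟩, ?_⟩
        · rintro (rfl | hba)
          · exact hirr _ hab
          · exact hirr _ (htrans a b a hab hba)
        · rintro ⟨rfl | hab, hn⟩
          · exact absurd (Or.inl rfl) hn
          · exact hab
      le_antisymm := by
        rintro a b (rfl | hab) (hba | hba)
        · rfl
        · rfl
        · exact hba.symm
        · exact absurd (htrans a b a hab hba) (hirr a)
      le_total := by
        intro a b
        by_cases hab : a = b
        · exact Or.inl (Or.inl hab)
        · rcases (hQ b (hDA b.2)).mem_or (hDA a.2) (fun e => hab (Subtype.ext e)) with h1 | h1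
          · exact Or.inl (Or.inr h1)
          · exact Or.inr (Or.inr (hfrom a b h1))
      toDecidableLE := fun _ _ => Classical.propDecidable _ }
  have hlt : ∀ a b : D, a < b ↔ a.1 ∈ Q₁ b.1 := fun a b => Iff.rfl
  have : Countable D := (hSc.mono inter_subset_left).to_subtype
  have : Nonempty D := by
    obtain ⟨d, -, hd⟩ := hdense A h.isOpen_left h.nonempty_left le_rfl
    exact ⟨⟨d, hd⟩⟩
  have : DenselyOrdered D := ⟨fun a b hab => by
    obtain ⟨w, hw⟩ := mem_closure_iff.1 ((hQ b (hDA b.2)).mem_closure_left hnc h (hx _ (hDA b.2)))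
      (Q₂ a.1) (hQ a (hDA a.2)).isOpen_right (hto a b hab)
    obtain ⟨d, hd, hdD⟩ := hdense _ ((hQ a (hDA a.2)).isOpen_right.inter
      (hQ b (hDA b.2)).isOpen_left) ⟨w, hw⟩ fun z hz => (hQ b (hDA b.2)).left_subset hz.2
    exact ⟨⟨d, hdD⟩, hfrom ⟨d, hdD⟩ a hd.1, hd.2⟩⟩
  have : NoMinOrder D := ⟨fun a => by
    have hne := (hQ a (hDA a.2)).left_nonempty hnc h (hx _ (hDA a.2))
    obtain ⟨d, hd, hdD⟩ := hdense _ (hQ a (hDA a.2)).isOpen_left hne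
      (hQ a (hDA a.2)).left_subset
    exact ⟨⟨d, hdD⟩, hd⟩⟩
  have : NoMaxOrder D := ⟨fun a => by
    have hne := (hQ a (hDA a.2)).right_nonempty hnc h (hy _ (hDA a.2))
    obtain ⟨d, hd, hdD⟩ := hdense _ (hQ a (hDA a.2)).isOpen_right hne
      (hQ a (hDA a.2)).right_subset
    exact ⟨⟨d, hdD⟩, hfrom ⟨d, hdD⟩ a hd⟩⟩
  have : Nonempty (Ioo (0 : ℚ) 1) := ⟨⟨1 / 2, by norm_num, by norm_num⟩⟩
  obtain ⟨e⟩ := Order.iso_of_countable_dense D (Ioo (0 : ℚ) 1)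
  refine ⟨D, fun z => if hz : z ∈ D then ((e ⟨z, hz⟩ : ℚ) : ℝ) else 0, hDA, hdense, ?_, ?_, ?_⟩
  · intro a ha b hb
    simp only [ha, hb, dif_pos]
    rw [Rat.cast_lt, Subtype.coe_lt_coe, e.lt_iff_lt, hlt]
  · intro a ha
    simp only [ha, dif_pos]
    exact ⟨by exact_mod_cast (e ⟨a, ha⟩).2.1, by exact_mod_cast (e ⟨a, ha⟩).2.2⟩
  · intro r r' h0 hrr h1
    obtain ⟨q, hq, hq'⟩ := exists_rat_btwn hrr
    have hq0 : (0 : ℚ) < q := by exact_mod_cast h0.trans_lt hq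
    have hq1 : q < (1 : ℚ) := by exact_mod_cast hq'.trans_le h1
    refine ⟨(e.symm ⟨q, hq0, hq1⟩).1, (e.symm ⟨q, hq0, hq1⟩).2, ?_⟩
    simp [hq, hq']

/-- A side of a separation by `{x, y}` all of whose points separate `x` from `y` is, together with
`x` and `y`, an arc from `x` to `y`. -/
lemma exists_arc_parametrization [TopologicalSpace.SeparableSpace X]
    (hnc : ∀ z : X, IsPreconnected ({z}ᶜ : Set X))
    (h : IsSeparation x y A B) (hE : A ⊆ cutSet A x y) :
    ∃ f : X → ℝ, ContinuousOn f (A ∪ {x, y}) ∧ InjOn f (A ∪ {x, y}) ∧ f x = 0 ∧ f y = 1 ∧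
      (∀ z ∈ A, 0 < f z ∧ f z < 1) := by
  have hE' : ∀ s ∈ A ∪ {x, y}, ∃ O₁ O₂, IsCutAt A x y s O₁ O₂ := by
    rintro s (hs | hs | hs)
    · exact (hE hs).2
    · exact hs ▸ (left_mem_cutSet h).2
    · exact hs ▸ (right_mem_cutSet h).2
  choose! Q₁ Q₂ hQ using hE'
  have hQA : ∀ s ∈ A, IsCutAt A x y s (Q₁ s) (Q₂ s) := fun s hs => hQ s (Or.inl hs)
  obtain ⟨D, φ, hDA, hdense, hφ, hφ01, hφd⟩ := exists_dense_orderIso hnc h hQA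
  have hxA := h.left_notMem
  have hyA := h.right_notMem
  have hQx : Q₁ x = ∅ := (hQ x (by simp)).left_eq_empty hnc h rfl
  have hQy : Q₂ y = ∅ := (hQ y (by simp)).swap.left_eq_empty hnc h.swap rfl
  have hQy' : Q₁ y = A := by
    have := (hQ y (by simp)).union_eq
    rwa [hQy, union_empty, sdiff_singleton_eq_self hyA] at this
  have hflip1 : ∀ s ∈ A, ∀ t ∈ A, s ∈ Q₁ t → t ∈ Q₂ s := fun s hs t ht hst =>
    (hQA s hs).mem_right_of_mem_left hnc (hQA t ht) h hst ht
  have hflip2 : ∀ s ∈ A, ∀ t ∈ A, s ∈ Q₂ t → t ∈ Q₁ s := fun s hs t ht hst =>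
    (hQA s hs).mem_left_of_mem_right hnc (hQA t ht) h hst ht
  -- the Dedekind cut of `p`; the junk value `sSup ∅ = 0` is the right one at `x`
  set f : X → ℝ := fun p => sSup (φ '' (D ∩ Q₁ p)) with hf
  have hbdd : ∀ p, BddAbove (φ '' (D ∩ Q₁ p)) := fun p => ⟨1, by
    rintro _ ⟨d, hd, rfl⟩
    exact (hφ01 d hd.1).2.le⟩
  have hle : ∀ p, ∀ d ∈ D, d ∈ Q₁ p → φ d ≤ f p := fun p d hd hdp =>
    le_csSup (hbdd p) ⟨d, ⟨hd, hdp⟩, rfl⟩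
  have hge : ∀ p ∈ A, ∀ d ∈ D, p ∈ Q₁ d → f p ≤ φ d := by
    intro p hp d hd hpd
    refine Real.sSup_le ?_ (hφ01 d hd).1.le
    rintro _ ⟨d', hd', rfl⟩
    exact ((hφ d' hd'.1 d hd).1
      ((hQA p hp).left_subset_left hnc (hQA d (hDA hd)) h hpd (hDA hd) hd'.2)).le
  have hfx : f x = 0 := by simp [hf, hQx]
  have hf1 : ∀ p, f p ≤ 1 := fun p => Real.sSup_le (by
    rintro _ ⟨d, hd, rfl⟩
    exact (hφ01 d hd.1).2.le) zero_le_one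
  have hf0 : ∀ p, 0 ≤ f p := fun p => Real.sSup_nonneg (by
    rintro _ ⟨d, hd, rfl⟩
    exact (hφ01 d hd.1).1.le)
  have hfy : f y = 1 := by
    refine le_antisymm (hf1 y) (le_of_forall_lt fun r hr => ?_)
    obtain ⟨d, hd, h1, -⟩ := hφd (max r 0) 1 (le_max_right _ _) (max_lt hr one_pos) le_rfl
    exact ((le_max_left _ _).trans_lt h1).trans_le (hle y d hd (hQy' ▸ hDA hd))
  have hbtw : ∀ p ∈ A, ∀ q ∈ A, p ∈ Q₁ q → ∃ d ∈ D, p ∈ Q₁ d ∧ d ∈ Q₁ q := by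
    intro p hp q hq hpq
    obtain ⟨w, hw⟩ := mem_closure_iff.1
      ((hQA q hq).mem_closure_left hnc h fun e => hxA (e ▸ hq)) (Q₂ p) (hQA p hp).isOpen_right
      (hflip1 p hp q hq hpq)
    obtain ⟨d, hd, hdD⟩ := hdense _ ((hQA p hp).isOpen_right.inter (hQA q hq).isOpen_left)
      ⟨w, hw⟩ fun z hz => (hQA q hq).left_subset hz.2
    exact ⟨d, hdD, hflip2 d (hDA hdD) p hp hd.1, hd.2⟩
  have hmono : ∀ p ∈ A, ∀ q ∈ A, p ∈ Q₁ q → f p < f q := by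
    intro p hp q hq hpq
    obtain ⟨d, hd, h1, h2⟩ := hbtw p hp q hq hpq
    obtain ⟨d', hd', h3, h4⟩ := hbtw d (hDA hd) q hq h2
    exact ((hge p hp d hd h1).trans_lt ((hφ d hd d' hd').1 h3)).trans_le (hle q d' hd' h4)
  have hf01 : ∀ z ∈ A, 0 < f z ∧ f z < 1 := by
    intro z hz
    have hne1 := (hQA z hz).left_nonempty hnc h fun e => hxA (e ▸ hz)
    have hne2 := (hQA z hz).right_nonempty hnc h fun e => hyA (e ▸ hz)
    obtain ⟨d, hd, hdD⟩ := hdense _ (hQA z hz).isOpen_left hne1 (hQA z hz).left_subset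
    obtain ⟨d', hd', hdD'⟩ := hdense _ (hQA z hz).isOpen_right hne2 (hQA z hz).right_subset
    exact ⟨(hφ01 d hdD).1.trans_le (hle z d hdD hd),
      (hge z hz d' hdD' (hflip2 d' (hDA hdD') z hz hd')).trans_lt (hφ01 d' hdD').2⟩
  refine ⟨f, ?_, ?_, hfx, hfy, hf01⟩
  · intro q hq
    refine tendsto_order.2 ⟨fun r hr => ?_, fun r hr => ?_⟩
    · by_cases hr0 : r < 0
      · exact Eventually.of_forall fun z => hr0.trans_le (hf0 z)
      have hne : (φ '' (D ∩ Q₁ q)).Nonempty := by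
        by_contra hne
        rw [not_nonempty_iff_eq_empty] at hne
        rw [show f q = sSup (φ '' (D ∩ Q₁ q)) from rfl, hne, Real.sSup_empty] at hr
        exact hr0 hr
      obtain ⟨_, ⟨d, ⟨hd, hdq⟩, rfl⟩, hrd⟩ := exists_lt_of_lt_csSup hne hr
      have hc := hQA d (hDA hd)
      have hqd : q ∈ (closure (Q₁ d) ∪ {d})ᶜ := by
        rintro (h1 | h1)
        · rcases hc.closure_left h1 with h2 | h2 | h2
          · exact hc.notMem_of_mem h2 (hc.mem_right_of_mem_left hnc
              (hQA q (hc.left_subset h2)) h hdq (hc.left_subset h2))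
          · rw [h2, hQx] at hdq; exact hdq
          · rw [mem_singleton_iff.1 h2] at hdq; exact hc.notMem_left hdq
        · rw [mem_singleton_iff.1 h1] at hdq; exact hc.notMem_left hdq
      have hop : IsOpen (closure (Q₁ d) ∪ {d})ᶜ :=
        (isClosed_closure.union isClosed_singleton).isOpen_compl
      filter_upwards [mem_nhdsWithin_of_mem_nhds (hop.mem_nhds hqd), self_mem_nhdsWithin]
        with z hz hzJ
      refine hrd.trans_le ?_
      rcases hzJ with h1 | h1 | h1
      · rcases hc.mem_or h1 fun e => hz (Or.inr e) with h2 | h2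
        · exact absurd (Or.inl (subset_closure h2)) hz
        · exact hle z d hd (hflip2 z h1 d (hDA hd) h2)
      · exact absurd (Or.inl (h1 ▸ hc.left_mem_closure hnc h fun e => hxA (e ▸ hDA hd))) hz
      · rw [mem_singleton_iff.1 h1, hfy]
        exact (hφ01 d hd).2.le
    · by_cases hr1 : 1 < r
      · exact Eventually.of_forall fun z => (hf1 z).trans_lt hr1
      push Not at hr1
      obtain ⟨d', hd', h1, h2⟩ := hφd (f q) r (hf0 q) hr hr1
      obtain ⟨d, hd, h3, h4⟩ := hφd (φ d') r (hφ01 d' hd').1.le h2 hr1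
      have hc := hQA d (hDA hd)
      have hdd : d' ∈ Q₁ d := (hφ d' hd' d hd).2 h3
      have hq1 : q ∉ Q₂ d := fun e => by
        have hqA := hc.right_subset e
        have := hle q d hd (hflip2 q hqA d (hDA hd) e)
        linarith
      have hqy : q ≠ y := fun e => by
        rw [e, hfy] at hr
        linarith
      have hqd : q ≠ d := fun e => by
        have := hle q d' hd' (e ▸ hdd)
        linarith
      have hq2 : q ∈ (closure (Q₂ d) ∪ {d})ᶜ := by
        rintro (h5 | h5)
        · rcases hc.closure_right h5 with h6 | h6 | h6
          exacts [hq1 h6, hqy h6, hqd h6]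
        · exact hqd h5
      have hop : IsOpen (closure (Q₂ d) ∪ {d})ᶜ :=
        (isClosed_closure.union isClosed_singleton).isOpen_compl
      have hyd : y ∈ closure (Q₂ d) := hc.right_mem_closure hnc h fun e => hyA (e ▸ hDA hd)
      filter_upwards [mem_nhdsWithin_of_mem_nhds (hop.mem_nhds hq2), self_mem_nhdsWithin]
        with z hz hzJ
      refine lt_of_le_of_lt ?_ h4
      rcases hzJ with h5 | h5 | h5
      · rcases hc.mem_or h5 fun e => hz (Or.inr e) with h6 | h6
        · exact hge z h5 d hd h6
        · exact absurd (Or.inl (subset_closure h6)) hz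
      · rw [h5, hfx]
        exact (hφ01 d hd).1.le
      · exact absurd (Or.inl (mem_singleton_iff.1 h5 ▸ hyd)) hz
  · have hxy : ∀ z ∈ A, f z ≠ f x ∧ f z ≠ f y := fun z hz => by
      rw [hfx, hfy]
      exact ⟨(hf01 z hz).1.ne', (hf01 z hz).2.ne⟩
    have hxy' : f x ≠ f y := by rw [hfx, hfy]; exact zero_ne_one
    rintro p (hp | hp | hp) q (hq | hq | hq) hpq
    · by_contra hne
      rcases (hQA q hq).mem_or hp hne with h1 | h1
      · exact (hmono p hp q hq h1).ne hpq
      · exact (hmono q hq p hp (hflip2 p hp q hq h1)).ne' hpq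
    all_goals try simp only [mem_singleton_iff] at *
    all_goals subst_vars
    · exact absurd hpq (hxy p hp).1
    · exact absurd hpq (hxy p hp).2
    · exact absurd hpq.symm (hxy q hq).1
    · rfl
    · exact absurd hpq hxy'
    · exact absurd hpq.symm (hxy q hq).2
    · exact absurd hpq.symm hxy'
    · rfl

end Arc

/-! ### The circle -/

section Circle

variable {X : Type*} [TopologicalSpace X]

/-- Two arcs with common endpoints, glued along these, form a circle. -/
lemma nonempty_homeomorph_circle_of_arcs [CompactSpace X] [T2Space X] {x y : X} {A B : Set X}
    (hnc : ∀ z : X, IsPreconnected ({z}ᶜ : Set X)) (h : IsSeparation x y A B) {f g : X → ℝ}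
    (hf : ContinuousOn f (A ∪ {x, y})) (hfi : InjOn f (A ∪ {x, y})) (hfx : f x = 0)
    (hfy : f y = 1) (hf01 : ∀ z ∈ A, 0 < f z ∧ f z < 1)
    (hg : ContinuousOn g (B ∪ {x, y})) (hgi : InjOn g (B ∪ {x, y})) (hgx : g x = 0)
    (hgy : g y = 1) (hg01 : ∀ z ∈ B, 0 < g z ∧ g z < 1) :
    Nonempty (X ≃ₜ Circle) := by
  classical
  set θ : X → ℝ := fun z => if z ∈ A ∪ {x, y} then Real.pi * f z else -(Real.pi * g z) with hθ
  have hpi := Real.pi_pos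
  have hA : ∀ z ∈ A ∪ {x, y}, θ z = Real.pi * f z := fun z hz => by simp only [hθ, if_pos hz]
  have hB : ∀ z ∈ B, z ∉ A ∪ {x, y} := by
    rintro z hz (h1 | h1 | h1)
    · exact h.notMem_of_mem h1 hz
    · exact h.symm.left_notMem (h1 ▸ hz)
    · exact h.symm.right_notMem (h1 ▸ hz)
  have hBθ : ∀ z ∈ B, θ z = -(Real.pi * g z) := fun z hz => by simp only [hθ, if_neg (hB z hz)]
  have hAB : ∀ z, z ∈ A ∪ {x, y} ∨ z ∈ B := fun z => by
    rcases h.mem_or z with h1 | h1 | h1 | h1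
    exacts [Or.inl (Or.inl h1), Or.inr h1, Or.inl (by simp [h1]), Or.inl (by simp [h1])]
  have hf01' : ∀ z ∈ A ∪ {x, y}, 0 ≤ f z ∧ f z ≤ 1 := by
    rintro z (h1 | h1 | h1)
    · exact ⟨(hf01 z h1).1.le, (hf01 z h1).2.le⟩
    · rw [h1, hfx]; exact ⟨le_rfl, zero_le_one⟩
    · rw [h1, hfy]; exact ⟨zero_le_one, le_rfl⟩
  have hneg : ∀ z ∈ B, -Real.pi < θ z ∧ θ z < 0 := fun z hz => by
    rw [hBθ z hz]
    have := hg01 z hz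
    constructor <;> nlinarith
  have hpos : ∀ z ∈ A ∪ {x, y}, 0 ≤ θ z ∧ θ z ≤ Real.pi := fun z hz => by
    rw [hA z hz]
    have := hf01' z hz
    constructor <;> nlinarith
  have hrange : ∀ z, -Real.pi < θ z ∧ θ z ≤ Real.pi := fun z => by
    rcases hAB z with hz | hz
    · have := hpos z hz
      constructor <;> linarith
    · have := hneg z hz
      constructor <;> linarith
  have hinj : Function.Injective θ := by
    intro z w hzw
    rcases hAB z with hz | hz <;> rcases hAB w with hw | hw
    · rw [hA z hz, hA w hw] at hzw
      exact hfi hz hw (mul_left_cancel₀ hpi.ne' hzw)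
    · linarith [hpos z hz, hneg w hw]
    · linarith [hpos w hw, hneg z hz]
    · rw [hBθ z hz, hBθ w hw, neg_inj] at hzw
      exact hgi (Or.inl hz) (Or.inl hw) (mul_left_cancel₀ hpi.ne' hzw)
  have harg : ∀ z, Complex.arg (Circle.exp (θ z)) = θ z := fun z =>
    Circle.arg_exp (hrange z).1 (hrange z).2
  have hcont : Continuous fun z => Circle.exp (θ z) := by
    have h1 : ContinuousOn (fun z => Circle.exp (θ z)) (A ∪ {x, y}) :=
      (Circle.exp.continuous.comp_continuousOn (hf.const_mul Real.pi)).congr fun z hz => by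
        simp only [hA z hz, Function.comp_apply]
    have h2 : ContinuousOn (fun z => Circle.exp (θ z)) (B ∪ {x, y}) := by
      have h3 : ContinuousOn (fun z => Circle.exp (-(Real.pi * g z))) (B ∪ {x, y}) :=
        Circle.exp.continuous.comp_continuousOn (hg.const_mul Real.pi).neg
      refine h3.congr ?_
      rintro z (hz | hz | hz)
      · simp only [hBθ z hz]
      · subst hz
        simp only [hA z (by simp), hfx, hgx, mul_zero, neg_zero]
      -- the angles at `y` are `π` and `-π`
      · rw [mem_singleton_iff] at hz
        subst hz
        simp only [hA z (by simp), hfy, hgy, mul_one]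
        rw [← Circle.exp_sub_two_pi]
        congr 1
        ring
    have hcl : ∀ {A B : Set X}, IsSeparation x y A B → IsClosed (A ∪ {x, y}) := fun {A B} h => by
      have : A ∪ {x, y} = Bᶜ := by
        ext z
        have h3 := h.mem_or z
        have h4 : z ∈ A → z ∉ B := h.notMem_of_mem
        have h5 := h.symm.left_notMem
        have h6 := h.symm.right_notMem
        simp only [mem_union, mem_insert_iff, mem_singleton_iff, mem_compl_iff]
        grind
      rw [this]
      exact h.isOpen_right.isClosed_compl
    rw [← continuousOn_univ]
    refine (h1.union_of_isClosed h2 (hcl h) (hcl h.symm)).mono fun z _ => ?_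
    rcases hAB z with hz | hz
    exacts [Or.inl hz, Or.inr (Or.inl hz)]
  have hbij : Function.Bijective fun z => Circle.exp (θ z) := by
    constructor
    · intro z w hzw
      apply hinj
      rw [← harg z, ← harg w]
      exact congrArg (fun c : Circle => Complex.arg c) hzw
    · intro c
      have h1 := Complex.neg_pi_lt_arg (c : ℂ)
      have h2 := Complex.arg_le_pi (c : ℂ)
      by_cases h0 : 0 ≤ Complex.arg c
      · have := (h.isPreconnected_union hnc).intermediate_value (by simp : x ∈ A ∪ {x, y})
          (by simp : y ∈ A ∪ {x, y}) hf
        rw [hfx, hfy] at this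
        obtain ⟨z, hz, hzc⟩ := this
          (⟨div_nonneg h0 hpi.le, (div_le_one hpi).2 h2⟩ : Complex.arg c / Real.pi ∈ Icc (0 : ℝ) 1)
        refine ⟨z, ?_⟩
        simp only [hA z hz, hzc]
        rw [mul_div_cancel₀ _ hpi.ne', Circle.exp_arg]
      · push Not at h0
        have := (h.symm.isPreconnected_union hnc).intermediate_value (by simp : x ∈ B ∪ {x, y})
          (by simp : y ∈ B ∪ {x, y}) hg
        rw [hgx, hgy] at this
        have h3 : 0 < -Complex.arg c / Real.pi := div_pos (by linarith) hpi
        have h4 : -Complex.arg c / Real.pi < 1 := (div_lt_one hpi).2 (by linarith)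
        obtain ⟨z, hz, hzc⟩ := this ⟨h3.le, h4.le⟩
        have hzB : z ∈ B := by
          rcases hz with hz | hz | hz
          · exact hz
          · rw [hz, hgx] at hzc; linarith
          · rw [hz, hgy] at hzc; linarith
        refine ⟨z, ?_⟩
        simp only [hBθ z hzB, hzc]
        rw [mul_div_cancel₀ _ hpi.ne', neg_neg, Circle.exp_arg]
  exact ⟨((isHomeomorph_iff_continuous_bijective).2 ⟨hcont, hbij⟩).homeomorph⟩

/-- A compact, Hausdorff, separable, locally connected space without cut points is a circle if it
has cut pairs and each of them is crossed by another one. -/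
theorem nonempty_homeomorph_circle_of_cutPair [CompactSpace X] [T2Space X] [LocallyConnectedSpace X]
    [TopologicalSpace.SeparableSpace X] (hnc : ∀ x : X, ¬ IsCutPoint x)
    (hpair : ∃ x y : X, IsCutPair x y)
    (hcross : ∀ x y : X, IsCutPair x y → ∃ u v : X, IsCutPair u v ∧ Crosses u v x y) :
    Nonempty (X ≃ₜ Circle) := by
  have hnc' : ∀ z : X, IsPreconnected ({z}ᶜ : Set X) := fun z => not_not.1 (hnc z)
  obtain ⟨x, y, hxy⟩ := hpair
  obtain ⟨A, B, h⟩ := hxy.exists_isSeparation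
  obtain ⟨f, hf, hfi, hfx, hfy, hf01⟩ :=
    exists_arc_parametrization hnc' h (subset_cutSet hnc' h hcross)
  obtain ⟨g, hg, hgi, hgx, hgy, hg01⟩ :=
    exists_arc_parametrization hnc' h.symm (subset_cutSet hnc' h.symm hcross)
  exact nonempty_homeomorph_circle_of_arcs hnc' h hf hfi hfx hfy hf01 hg hgi hgx hgy hg01

lemma Homeomorph.isPreconnected_compl_image_iff {Y : Type*} [TopologicalSpace Y] (e : X ≃ₜ Y)
    (S : Set X) : IsPreconnected (e '' S)ᶜ ↔ IsPreconnected Sᶜ := by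
  rw [← image_compl_eq e.bijective, e.isPreconnected_image]

/-- On a circle there are no cut points and any two distinct points form a cut pair. -/
lemma isCutPair_of_homeomorph_circle (e : X ≃ₜ Circle) :
    (∀ x : X, ¬ IsCutPoint x) ∧ ∀ x y : X, x ≠ y → IsCutPair x y := by
  have h1 : ∀ x : X, ¬ IsCutPoint x := fun x hx => hx <| by
    rw [← e.isPreconnected_compl_image_iff, image_singleton]
    exact (Circle.isPathConnected_compl_singleton _).isConnected.isPreconnected
  refine ⟨h1, fun x y hxy => ⟨hxy, fun h => ?_, h1 x, h1 y⟩⟩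
  rw [← e.isPreconnected_compl_image_iff, image_pair] at h
  exact Circle.not_isPreconnected_compl_pair (e.injective.ne hxy) h

lemma IsSeparation.crosses {x y u v : X} {A B : Set X} (h : IsSeparation x y A B) (hu : u ∈ A)
    (hv : v ∈ B) : Crosses u v x y := by
  have hA : u ∈ ({x, y}ᶜ : Set X) := h.union_eq ▸ Or.inl hu
  refine ⟨hA, h.union_eq ▸ Or.inr hv, fun hcon => ?_⟩
  have hsub : connectedComponentIn ({x, y}ᶜ : Set X) u ⊆ A ∪ B :=
    h.union_eq ▸ connectedComponentIn_subset _ _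
  have := isPreconnected_connectedComponentIn.subset_left_of_subset_union h.isOpen_left
    h.isOpen_right h.disjoint hsub ⟨u, mem_connectedComponentIn hA, hu⟩
  exact h.notMem_of_mem (this hcon) hv

lemma cutPair_conditions_of_homeomorph_circle (e : X ≃ₜ Circle) :
    ConnectedSpace X ∧ (∀ x : X, ¬ IsCutPoint x) ∧ (∃ x y : X, IsCutPair x y) ∧
      ∀ x y : X, IsCutPair x y → ∃ u v : X, IsCutPair u v ∧ Crosses u v x y := by
  have : T1Space X := e.symm.t1Space
  obtain ⟨h1, h2⟩ := isCutPair_of_homeomorph_circle e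
  have hconn : ConnectedSpace X := e.symm.surjective.connectedSpace e.symm.continuous
  refine ⟨hconn, h1, ⟨e.symm 1, e.symm (-1), h2 _ _ fun h => ?_⟩, fun x y hxy => ?_⟩
  · have := congrArg (fun c : Circle => (c : ℂ).re) (e.symm.injective h)
    norm_num at this
  · obtain ⟨A, B, h⟩ := hxy.exists_isSeparation
    obtain ⟨u, hu⟩ := h.nonempty_left
    obtain ⟨v, hv⟩ := h.nonempty_right
    exact ⟨u, v, h2 u v fun e => h.notMem_of_mem hu (e ▸ hv), h.crosses hu hv⟩

end Circle

/-! ### Reduced words and products -/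

section Words

variable {α : Type*} [DecidableEq α] {k : ℕ}

namespace FreeGroup

lemma take_toWord_mul_mk_singleton {g : FreeGroup α} (a : α × Bool) (hk : k + 1 ≤ g.norm) :
    (g * mk [a]).toWord.take k = g.toWord.take k := by
  have hne : g.toWord ≠ [] := fun h => by
    have : g.norm = 0 := by rw [norm, h, List.length_nil]
    omega
  obtain ⟨L, c, hL⟩ : ∃ L c, g.toWord = L ++ [c] :=
    ⟨_, _, (List.dropLast_append_getLast hne).symm⟩
  have hlen : k ≤ L.length := by
    rw [norm, hL] at hk
    simpa using hk
  have hred : IsReduced (L ++ [c]) := hL ▸ isReduced_toWord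
  have hg : g = mk (L ++ [c]) := by rw [← hL, mk_toWord]
  rw [hL, List.take_append_of_le_length hlen]
  by_cases hc : c.1 = a.1 → c.2 = a.2
  · have hred' : IsReduced (L ++ [c] ++ [a]) := by
      refine List.IsChain.append hred (List.isChain_singleton a) ?_
      simpa using hc
    rw [hg, mul_mk, toWord_mk, hred'.reduce_eq, List.append_assoc,
      List.take_append_of_le_length hlen]
  · push Not at hc
    have h1 : mk (L ++ [c]) * mk [a] = mk L := by
      obtain ⟨c₁, c₂⟩ := c
      obtain ⟨a₁, a₂⟩ := a
      obtain ⟨rfl, h2⟩ := hc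
      have : a₂ = !c₂ := by cases c₂ <;> cases a₂ <;> simp_all
      subst this
      rw [mul_mk, List.append_assoc]
      have h3 : mk (L ++ (c₁, c₂) :: (c₁, !c₂) :: []) = mk (L ++ []) := Quot.sound Red.Step.not
      simpa using h3
    rw [hg, h1, toWord_mk, (hred.infix ⟨[], [c], by simp⟩ : IsReduced L).reduce_eq]

/-- Right multiplication by `h` changes at most the last `|h|` letters of a reduced word. -/
lemma take_toWord_mul {g h : FreeGroup α} (hk : k + h.norm ≤ g.norm) :
    (g * h).toWord.take k = g.toWord.take k := by
  have key : ∀ (L : List (α × Bool)) (g : FreeGroup α), k + L.length ≤ g.norm →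
      (g * mk L).toWord.take k = g.toWord.take k := by
    intro L
    induction L with
    | nil => intro g _; rw [← one_eq_mk, mul_one]
    | cons a L ih =>
      intro g hg
      rw [List.length_cons] at hg
      have h1 : mk (a :: L) = mk [a] * mk L := by rw [mul_mk]; rfl
      have h2 : g.norm ≤ (g * mk [a]).norm + 1 := by
        have h3 := norm_mul_le (g * mk [a]) (mk [a])⁻¹
        rw [mul_inv_cancel_right, norm_inv_eq] at h3
        have h4 : (mk [a]).norm ≤ 1 := norm_mk_le
        omega
      rw [h1, ← mul_assoc, ih _ (by omega), take_toWord_mul_mk_singleton a (by omega)]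
  rw [← mk_toWord (x := h)]
  exact key h.toWord g hk

lemma finite_norm_le [Finite α] (C : ℕ) : {g : FreeGroup α | g.norm ≤ C}.Finite :=
  ((List.finite_length_le (α × Bool) C).preimage toWord_injective.injOn)

end FreeGroup

end Words

/-! ### Lines and their ends -/

section Ends

variable {n : ℕ}

namespace TreeBoundary

/-- The word formed by the first `k` letters of a boundary point. -/
def initial (ξ : TreeBoundary n) (k : ℕ) : List (Fin n × Bool) := (List.range k).map ξ.1

@[simp] lemma length_initial (ξ : TreeBoundary n) (k : ℕ) : (ξ.initial k).length = k := by
  simp [initial]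

lemma take_initial (ξ : TreeBoundary n) {k l : ℕ} (h : k ≤ l) :
    (ξ.initial l).take k = ξ.initial k := by
  rw [initial, ← List.map_take, List.take_range, min_eq_left h, initial]

lemma initial_eq_iff {ξ η : TreeBoundary n} {k : ℕ} :
    ξ.initial k = η.initial k ↔ ∀ i < k, ξ.1 i = η.1 i := by
  simp [initial, List.map_inj_left]

lemma ext_initial {ξ η : TreeBoundary n} (h : ∀ k, ξ.initial k = η.initial k) : ξ = η :=
  Subtype.ext (funext fun i => initial_eq_iff.1 (h (i + 1)) i (Nat.lt_succ_self i))

end TreeBoundary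

/-- The elements `g m` of the free group converge to the boundary point `ξ` along the filter `l`:
their reduced words eventually begin with any given initial word of `ξ`. -/
def TendsToEnd {ι : Type*} (l : Filter ι) (g : ι → FreeGroup (Fin n)) (ξ : TreeBoundary n) :
    Prop :=
  ∀ k, ∀ᶠ m in l, (g m).toWord.take k = ξ.initial k

namespace TendsToEnd

variable {ι κ : Type*} {l : Filter ι} {l' : Filter κ} {g : ι → FreeGroup (Fin n)}
  {ξ η : TreeBoundary n}

lemma unique [l.NeBot] (h : TendsToEnd l g ξ) (h' : TendsToEnd l g η) : ξ = η :=
  TreeBoundary.ext_initial fun k => by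
    obtain ⟨m, h1, h2⟩ := ((h k).and (h' k)).exists
    exact h1.symm.trans h2

lemma comp (h : TendsToEnd l g ξ) {φ : κ → ι} (hφ : Tendsto φ l' l) :
    TendsToEnd l' (fun m => g (φ m)) ξ := fun k => hφ.eventually (h k)

lemma congr' {g' : ι → FreeGroup (Fin n)} (h : TendsToEnd l g ξ) (hg : ∀ᶠ m in l, g m = g' m) :
    TendsToEnd l g' ξ := fun k => by
  filter_upwards [h k, hg] with m h1 h2
  rwa [← h2]

/-- Sequences at bounded distance have the same limits. -/
lemma mul_right (h : TendsToEnd l g ξ) (a : FreeGroup (Fin n)) :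
    TendsToEnd l (fun m => g m * a) ξ := fun k => by
  filter_upwards [h (k + a.norm)] with m hm
  have hlen : k + a.norm ≤ (g m).norm := by
    have := congrArg List.length hm
    rw [List.length_take, TreeBoundary.length_initial] at this
    exact min_eq_left_iff.1 this
  rw [FreeGroup.take_toWord_mul hlen, ← TreeBoundary.take_initial ξ (Nat.le_add_right k a.norm),
    ← hm, List.take_take, min_eq_left (Nat.le_add_right k a.norm)]

end TendsToEnd

lemma ConvergesToEnd.tendsToEnd {F : Type*} [Group F] {b : FreeGroupBasis (Fin n) F}
    {g : ℕ → F} {ξ : TreeBoundary n} (h : ConvergesToEnd b g ξ) :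
    TendsToEnd atTop (fun m => b.repr (g m)) ξ := by
  intro k
  have h1 : ∀ᶠ m in atTop, ∀ i ∈ Finset.range k, (b.repr (g m)).toWord[i]? = some (ξ.1 i) :=
    (eventually_all_finset _).2 fun i _ => h i
  filter_upwards [h1] with m hm
  apply List.ext_getElem?
  intro i
  rw [List.getElem?_take, TreeBoundary.initial, List.getElem?_map]
  split_ifs with hi
  · rw [hm i (Finset.mem_range.2 hi), List.getElem?_range hi, Option.map_some]
  · rw [List.getElem?_eq_none (by simpa using hi), Option.map_none]

/-- `ξ` and `η` are the ends `g w^∞` and `g w^{-∞}` of the line `m ↦ g w^m`. -/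
structure IsAxis (g w : FreeGroup (Fin n)) (ξ η : TreeBoundary n) : Prop where
  top : TendsToEnd (atTop : Filter ℤ) (fun m => g * w ^ m) ξ
  bot : TendsToEnd (atTop : Filter ℤ) (fun m => g * w⁻¹ ^ m) η

namespace IsAxis

variable {g w g₁ w₁ g₂ w₂ : FreeGroup (Fin n)} {ξ η η₁ η₂ : TreeBoundary n} {k : ℕ}

lemma symm (h : IsAxis g w ξ η) : IsAxis g w⁻¹ η ξ := ⟨h.bot, by simpa using h.top⟩

lemma shift (h : IsAxis g w ξ η) (j : ℤ) : IsAxis (g * w ^ j) w ξ η where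
  top := (h.top.comp (tendsto_atTop_add_const_right atTop j tendsto_id)).congr'
    (Eventually.of_forall fun m => by
      simp only [id]
      rw [mul_assoc, ← zpow_add, add_comm])
  bot := (h.bot.comp (tendsto_atTop_add_const_right atTop (-j) tendsto_id)).congr'
    (Eventually.of_forall fun m => by
      simp only [id]
      rw [mul_assoc, inv_zpow', inv_zpow', ← zpow_add]
      congr 2
      ring)

/-- Where the first `k` letters along a line become those of its end, the line is close to the
base vertex. -/
lemma exists_norm_lt (h : IsAxis g w ξ η) {m₀ : ℤ}
    (h0 : (g * w ^ m₀).toWord.take k ≠ ξ.initial k) :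
    ∃ m ≥ m₀, (g * w ^ m).norm < k + w.norm ∧
      (g * w ^ (m + 1)).toWord.take k = ξ.initial k := by
  obtain ⟨M, hM⟩ := eventually_atTop.1 (h.top k)
  have hex : ∃ m ≥ m₀, (g * w ^ m).toWord.take k ≠ ξ.initial k ∧
      (g * w ^ (m + 1)).toWord.take k = ξ.initial k := by
    by_contra! hcon
    have key : ∀ j : ℕ, (g * w ^ (m₀ + j)).toWord.take k ≠ ξ.initial k := by
      intro j
      induction j with
      | zero => simpa using h0
      | succ j ih =>
        have := hcon (m₀ + j) (by omega) ih
        rwa [add_assoc] at this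
    exact key (M - m₀).toNat (hM _ (by omega))
  obtain ⟨m, hm, h1, h2⟩ := hex
  refine ⟨m, hm, ?_, h2⟩
  by_contra! hcon
  rw [zpow_add_one, ← mul_assoc, FreeGroup.take_toWord_mul hcon] at h2
  exact h1 h2

/-- Only finitely many pairs of ends of lines differ in their first `k` letters: such a line passes
close to the base vertex. -/
lemma finite_setOf {V : Set (FreeGroup (Fin n))} (hV : V.Finite) (k : ℕ) :
    {p : TreeBoundary n × TreeBoundary n | p.1.initial k ≠ p.2.initial k ∧
      ∃ w ∈ V, ∃ g, IsAxis g w p.1 p.2}.Finite := by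
  have hfin : (⋃ w ∈ V, ⋃ g ∈ {g : FreeGroup (Fin n) | g.norm ≤ k + w.norm},
      {p : TreeBoundary n × TreeBoundary n | IsAxis g w p.1 p.2}).Finite := by
    refine hV.biUnion fun w _ => (FreeGroup.finite_norm_le _).biUnion fun g _ => ?_
    refine Set.Subsingleton.finite fun p hp q hq => ?_
    exact Prod.ext (TendsToEnd.unique hp.top hq.top) (TendsToEnd.unique hp.bot hq.bot)
  refine hfin.subset ?_
  rintro ⟨ξ, η⟩ ⟨hne, w, hw, g, h⟩
  obtain ⟨M, hM⟩ := (h.bot k).exists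
  obtain ⟨m, -, hm, -⟩ := h.exists_norm_lt (k := k) (m₀ := -M) (by
    rw [← inv_zpow', hM]
    exact hne.symm)
  simp only [mem_iUnion]
  exact ⟨w, hw, g * w ^ m, hm.le, h.shift m⟩

/-- Two lines with a common end fellow travel along it. -/
lemma exists_norm_le (h₁ : IsAxis g₁ w₁ ξ η₁) (h₂ : IsAxis g₂ w₂ ξ η₂) (M : ℤ) :
    ∃ m₁ ≥ M, ∃ m₂ ≥ M,
      ((g₁ * w₁ ^ m₁)⁻¹ * (g₂ * w₂ ^ m₂)).norm ≤ 2 * w₁.norm + 2 * w₂.norm := by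
  obtain ⟨k, hk₁, hk₂⟩ : ∃ k, (g₁ * w₁ ^ M).norm < k ∧ (g₂ * w₂ ^ M).norm < k :=
    ⟨max (g₁ * w₁ ^ M).norm (g₂ * w₂ ^ M).norm + 1, by omega, by omega⟩
  have key : ∀ {g w : FreeGroup (Fin n)} {η : TreeBoundary n}, IsAxis g w ξ η →
      (g * w ^ M).norm < k → ∃ m ≥ M, ∃ r : FreeGroup (Fin n), r.norm ≤ 2 * w.norm ∧
        g * w ^ m = FreeGroup.mk (ξ.initial k) * r := by
    intro g w η h hk
    obtain ⟨m, hm, h1, h2⟩ := h.exists_norm_lt (k := k) (m₀ := M) (fun e => by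
      have := congrArg List.length e
      rw [List.length_take, TreeBoundary.length_initial] at this
      have h3 := min_eq_left_iff.1 this
      rw [FreeGroup.norm] at hk
      omega)
    refine ⟨m + 1, by omega, FreeGroup.mk ((g * w ^ (m + 1)).toWord.drop k), ?_, ?_⟩
    · refine FreeGroup.norm_mk_le.trans ?_
      have h3 := FreeGroup.norm_mul_le (g * w ^ m) w
      rw [mul_assoc, ← zpow_add_one] at h3
      rw [List.length_drop]
      change (g * w ^ (m + 1)).norm - k ≤ _
      omega
    · rw [← h2, FreeGroup.mul_mk, List.take_append_drop, FreeGroup.mk_toWord]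
  obtain ⟨m₁, hm₁, r₁, hr₁, e₁⟩ := key h₁ hk₁
  obtain ⟨m₂, hm₂, r₂, hr₂, e₂⟩ := key h₂ hk₂
  refine ⟨m₁, hm₁, m₂, hm₂, ?_⟩
  rw [e₁, e₂, mul_inv_rev, mul_assoc, inv_mul_cancel_left]
  refine (FreeGroup.norm_mul_le _ _).trans ?_
  rw [FreeGroup.norm_inv_eq]
  omega

/-- Two lines with one common end have both ends in common: by the pigeonhole principle, some
positive powers of the two translations coincide. -/
lemma eq_of_eq (h₁ : IsAxis g₁ w₁ ξ η₁) (h₂ : IsAxis g₂ w₂ ξ η₂) : η₁ = η₂ := by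
  choose m₁ hm₁ m₂ hm₂ hle using h₁.exists_norm_le h₂
  obtain ⟨a, ha⟩ : ∃ a, ∃ᶠ M in (atTop : Filter ℤ),
      (g₁ * w₁ ^ m₁ M)⁻¹ * (g₂ * w₂ ^ m₂ M) = a := by
    by_contra! hcon
    have := (eventually_all_finite (FreeGroup.finite_norm_le (α := Fin n)
      (2 * w₁.norm + 2 * w₂.norm))).2 fun a _ => hcon a
    obtain ⟨M, hM⟩ := this.exists
    exact hM _ (hle M) rfl
  obtain ⟨M, hM⟩ := ha.exists
  obtain ⟨M', hM', hMM'⟩ := (frequently_atTop.1 ha) (max (m₁ M) (m₂ M) + 1)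
  have hN₁ : 0 < m₁ M' - m₁ M := by have := hm₁ M'; omega
  have hN₂ : 0 < m₂ M' - m₂ M := by have := hm₂ M'; omega
  set N₁ := m₁ M' - m₁ M
  set N₂ := m₂ M' - m₂ M
  have hc : g₁ * w₁ ^ N₁ * g₁⁻¹ = g₂ * w₂ ^ N₂ * g₂⁻¹ := by
    have e1 : g₂ * w₂ ^ m₂ M = g₁ * w₁ ^ m₁ M * a := by rw [← hM]; group
    have e2 : g₂ * w₂ ^ m₂ M' = g₁ * w₁ ^ m₁ M' * a := by rw [← hMM']; group
    calc g₁ * w₁ ^ N₁ * g₁⁻¹ = (g₁ * w₁ ^ m₁ M' * a) * (g₁ * w₁ ^ m₁ M * a)⁻¹ := by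
          rw [zpow_sub]; group
      _ = g₂ * w₂ ^ N₂ * g₂⁻¹ := by
          rw [← e1, ← e2, zpow_sub]; group
  have t₁ := ((h₁.bot.comp (tendsto_id.const_mul_atTop' hN₁)).mul_right (g₁⁻¹ * g₂))
  have t₂ := h₂.bot.comp (tendsto_id.const_mul_atTop' hN₂)
  refine TendsToEnd.unique t₁ (t₂.congr' (Eventually.of_forall fun j => ?_))
  have e : (g₁ * w₁ ^ N₁ * g₁⁻¹) ^ (-j) = (g₂ * w₂ ^ N₂ * g₂⁻¹) ^ (-j) := by rw [hc]
  rw [conj_zpow, conj_zpow, ← zpow_mul, ← zpow_mul, mul_neg, mul_neg] at e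
  simp only [id, inv_zpow']
  calc g₂ * w₂ ^ (-(N₂ * j)) = g₂ * w₂ ^ (-(N₂ * j)) * g₂⁻¹ * g₂ := by group
    _ = g₁ * w₁ ^ (-(N₁ * j)) * (g₁⁻¹ * g₂) := by rw [← e]; group

end IsAxis

end Ends

/-! ### Quotients of compact spaces -/

section Quotient

variable {Z X : Type*} {q : Z → X}

/-- The points of `K` that are identified with a point outside `K`. -/
def crossingPoints (q : Z → X) (K : Set Z) : Set Z := {a | a ∈ K ∧ ∃ b ∉ K, q a = q b}

lemma crossingPoints_union_subset (K L : Set Z) :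
    crossingPoints q (K ∪ L) ⊆ crossingPoints q K ∪ crossingPoints q L := by
  rintro a ⟨ha | ha, b, hb, hab⟩
  · exact Or.inl ⟨ha, b, fun h => hb (Or.inl h), hab⟩
  · exact Or.inr ⟨ha, b, fun h => hb (Or.inr h), hab⟩

variable [TopologicalSpace Z] [CompactSpace Z] [TopologicalSpace X]

/-- A quotient of a compact Hausdorff space by a closed equivalence relation is Hausdorff. -/
lemma Topology.IsQuotientMap.t2Space_of_isClosed [T2Space Z] (hq : IsQuotientMap q)
    (hR : IsClosed {p : Z × Z | q p.1 = q p.2}) : T2Space X := by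
  have hclosed : IsClosedMap q := by
    intro C hC
    rw [← hq.isClosed_preimage]
    have : q ⁻¹' (q '' C) = Prod.snd '' ({p : Z × Z | q p.1 = q p.2} ∩ Prod.fst ⁻¹' C) := by
      ext z
      constructor
      · rintro ⟨c, hc, hcz⟩
        exact ⟨(c, z), ⟨hcz, hc⟩, rfl⟩
      · rintro ⟨⟨c, z⟩, ⟨h1, h2⟩, rfl⟩
        exact ⟨c, h2, h1⟩
    rw [this]
    exact ((hR.inter (hC.preimage continuous_fst)).isCompact.image continuous_snd).isClosed
  have hfib : ∀ z, IsClosed {z' | q z' = q z} := fun z =>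
    hR.preimage (continuous_id.prodMk continuous_const)
  refine ⟨fun x y hxy => ?_⟩
  obtain ⟨z, rfl⟩ := hq.surjective x
  obtain ⟨w, rfl⟩ := hq.surjective y
  obtain ⟨U, V, hU, hV, hzU, hwV, hUV⟩ := normal_separation (hfib z) (hfib w)
    (disjoint_left.2 fun t h1 h2 => hxy (h1.symm.trans h2))
  refine ⟨(q '' Uᶜ)ᶜ, (q '' Vᶜ)ᶜ, (hclosed _ hU.isClosed_compl).isOpen_compl,
    (hclosed _ hV.isClosed_compl).isOpen_compl, ?_, ?_, ?_⟩
  · rintro ⟨t, ht, hte⟩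
    exact ht (hzU hte)
  · rintro ⟨t, ht, hte⟩
    exact ht (hwV hte)
  · rw [disjoint_left]
    intro x h1 h2
    obtain ⟨t, rfl⟩ := hq.surjective x
    have h3 : t ∈ U := by
      by_contra h
      exact h1 ⟨t, h, rfl⟩
    have h4 : t ∈ V := by
      by_contra h
      exact h2 ⟨t, h, rfl⟩
    exact disjoint_left.1 hUV h3 h4

/-- If `X` is connected, a component of the image of a clopen set `K` that contained no image of a
crossing point of `K` could be separated, within the image of `K`, from these finitely many
points by a clopen set, and that set would be clopen in `X`, as its preimage misses them. -/
lemma exists_crossingPoint_mem_connectedComponentIn [T2Space X] [PreconnectedSpace X]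
    (hq : IsQuotientMap q) {K : Set Z} (hK : IsClopen K) (hfin : (crossingPoints q K).Finite)
    {y : X} (hy : y ∈ q '' K) (hne : q '' K ≠ univ) :
    ∃ p ∈ crossingPoints q K, y ∈ connectedComponentIn (q '' K) (q p) := by
  by_contra! hcon
  have hqK : IsCompact (q '' K) := hK.1.isCompact.image hq.continuous
  have : CompactSpace (q '' K) := isCompact_iff_compactSpace.1 hqK
  have hex : ∀ p ∈ crossingPoints q K, ∃ C : Set (q '' K), IsClopen C ∧ ⟨y, hy⟩ ∈ C ∧
      ∀ c ∈ C, (c : X) ≠ q p := by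
    intro p hp
    have hpK : q p ∈ q '' K := mem_image_of_mem q hp.1
    have h1 : (⟨q p, hpK⟩ : q '' K) ∉ connectedComponent (⟨y, hy⟩ : q '' K) := by
      intro h
      refine hcon p hp ?_
      rw [connectedComponentIn_eq_image hpK]
      refine ⟨⟨y, hy⟩, ?_, rfl⟩
      rw [← connectedComponent_eq h]
      exact mem_connectedComponent
    rw [connectedComponent_eq_iInter_isClopen, mem_iInter] at h1
    push Not at h1
    obtain ⟨⟨C, hC, hyC⟩, hpC⟩ := h1
    exact ⟨C, hC, hyC, fun c hc e => hpC (by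
      have : c = ⟨q p, hpK⟩ := Subtype.ext e
      exact this ▸ hc)⟩
  choose! C hC hyC hCp using hex
  set E : Set (q '' K) := ⋂ p ∈ crossingPoints q K, C p with hE
  have hEc : IsClopen E := hfin.isClopen_biInter hC
  have hyE : ⟨y, hy⟩ ∈ E := mem_iInter₂.2 hyC
  have himg : ∀ S : Set (q '' K), IsClosed S → IsClosed ((↑) '' S : Set X) := fun S hS =>
    hqK.isClosed.isClosedEmbedding_subtypeVal.isClosedMap S hS
  have hpre : (q ⁻¹' ((↑) '' E))ᶜ = Kᶜ ∪ (K ∩ q ⁻¹' ((↑) '' Eᶜ)) := by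
    ext z
    constructor
    · intro hz
      by_cases hzK : z ∈ K
      · refine Or.inr ⟨hzK, ⟨q z, mem_image_of_mem q hzK⟩, fun h => hz ⟨_, h, rfl⟩, rfl⟩
      · exact Or.inl hzK
    · rintro (hzK | ⟨hzK, c, hc, hcz⟩) ⟨c', hc', hcz'⟩
      · obtain ⟨k, hk, hkc⟩ := c'.2
        have hkP : k ∈ crossingPoints q K := ⟨hk, z, hzK, hkc.trans hcz'⟩
        exact hCp k hkP c' (mem_iInter₂.1 hc' k hkP) hkc.symm
      · exact hc ((Subtype.ext (hcz.trans hcz'.symm) : c = c') ▸ hc')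
  have hopen : IsOpen ((↑) '' E : Set X) := by
    rw [← hq.isOpen_preimage, ← isClosed_compl_iff, hpre]
    exact hK.2.isClosed_compl.union
      (hK.1.inter ((himg _ hEc.2.isClosed_compl).preimage hq.continuous))
  have huniv : ((↑) '' E : Set X) = univ :=
    IsClopen.eq_univ ⟨himg _ hEc.1, hopen⟩ ⟨y, _, hyE, rfl⟩
  exact hne (eq_univ_of_forall fun x => by
    obtain ⟨c, -, rfl⟩ : x ∈ ((↑) '' E : Set X) := huniv ▸ mem_univ x
    exact c.2)

/-- A connected Hausdorff quotient of a compact Hausdorff space with a basis of clopen sets with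
finitely many crossing points is locally connected, because the images of these clopen sets have
finitely many components. -/
lemma locallyConnectedSpace_of_finite_crossingPoints [T2Space X] [PreconnectedSpace X]
    (hq : IsQuotientMap q)
    (hbasis : ∀ z : Z, ∀ U : Set Z, IsOpen U → z ∈ U → ∃ K : Set Z, IsClopen K ∧ z ∈ K ∧ K ⊆ U ∧
      (crossingPoints q K).Finite) : LocallyConnectedSpace X := by
  rw [locallyConnectedSpace_iff_connected_subsets]
  intro x U hU
  obtain ⟨U', hU'U, hU', hxU'⟩ := mem_nhds_iff.1 hU
  have hfib : IsCompact (q ⁻¹' {x}) := (isClosed_singleton.preimage hq.continuous).isCompact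
  obtain ⟨K, hK, hfK, hKU, hKfin⟩ : ∃ K : Set Z, IsClopen K ∧ q ⁻¹' {x} ⊆ K ∧ K ⊆ q ⁻¹' U' ∧
      (crossingPoints q K).Finite := by
    refine hfib.induction_on (p := fun s => ∃ K : Set Z, IsClopen K ∧ s ⊆ K ∧ K ⊆ q ⁻¹' U' ∧
      (crossingPoints q K).Finite) ?_ ?_ ?_ ?_
    · refine ⟨∅, isClopen_empty, le_rfl, empty_subset _, ?_⟩
      simp [crossingPoints]
    · rintro s t hst ⟨K, h1, h2, h3⟩
      exact ⟨K, h1, hst.trans h2, h3⟩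
    · rintro s t ⟨K, h1, h2, h3, h4⟩ ⟨L, k1, k2, k3, k4⟩
      exact ⟨K ∪ L, h1.union k1, union_subset_union h2 k2, union_subset h3 k3,
        (h4.union k4).subset (crossingPoints_union_subset K L)⟩
    · intro z hz
      obtain ⟨K, h1, h2, h3, h4⟩ := hbasis z (q ⁻¹' U') (hU'.preimage hq.continuous)
        (by rw [mem_preimage, mem_singleton_iff.1 hz]; exact hxU')
      exact ⟨K, mem_nhdsWithin_of_mem_nhds (h1.2.mem_nhds h2), K, h1, le_rfl, h3, h4⟩
  have hqKc : IsClosed (q '' K) := (hK.1.isCompact.image hq.continuous).isClosed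
  have hqK : q '' K ∈ 𝓝 x := by
    have hop : IsOpen (q '' Kᶜ)ᶜ :=
      (hK.2.isClosed_compl.isCompact.image hq.continuous).isClosed.isOpen_compl
    refine mem_of_superset (hop.mem_nhds ?_) fun y hy => ?_
    · rintro ⟨z, hz, hzx⟩
      exact hz (hfK hzx)
    · obtain ⟨z, rfl⟩ := hq.surjective y
      exact mem_image_of_mem q (by
        by_contra hz
        exact hy ⟨z, hz, rfl⟩)
  have hqKU : q '' K ⊆ U := (image_subset_iff.2 hKU).trans hU'U
  have hxK : x ∈ q '' K := mem_of_mem_nhds hqK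
  refine ⟨connectedComponentIn (q '' K) x, ?_, isPreconnected_connectedComponentIn,
    (connectedComponentIn_subset _ _).trans hqKU⟩
  by_cases hne : q '' K = univ
  · rw [hne, (isPreconnected_univ (α := X)).connectedComponentIn (mem_univ x)]
    exact univ_mem
  have hcomp : ∀ y, IsClosed (connectedComponentIn (q '' K) y) := by
    intro y
    refine closure_subset_iff_isClosed.1 fun z hz => ?_
    exact closure_connectedComponentIn_subset _ _
      ⟨hz, closure_minimal (connectedComponentIn_subset _ _) hqKc hz⟩
  set P := {p ∈ crossingPoints q K | x ∉ connectedComponentIn (q '' K) (q p)} with hP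
  have hPc : IsClosed (⋃ p ∈ P, connectedComponentIn (q '' K) (q p)) :=
    (hKfin.subset (sep_subset _ _)).isClosed_biUnion fun p _ => hcomp _
  have hxP : x ∈ (⋃ p ∈ P, connectedComponentIn (q '' K) (q p))ᶜ := by
    simp only [mem_compl_iff, mem_iUnion, not_exists]
    exact fun p hp => hp.2
  filter_upwards [hqK, hPc.isOpen_compl.mem_nhds hxP] with y hy hyP
  obtain ⟨p, hp, hyp⟩ := exists_crossingPoint_mem_connectedComponentIn hq hK hKfin hy hne
  have hxp : x ∈ connectedComponentIn (q '' K) (q p) := by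
    by_contra h
    exact hyP (mem_iUnion₂.2 ⟨p, ⟨hp, h⟩, hyp⟩)
  rw [← connectedComponentIn_eq hxp]
  exact hyp

end Quotient

/-! ### The boundary of the tree -/

section Boundary

variable {n : ℕ}

instance : T2Space (TreeBoundary n) :=
  inferInstanceAs (T2Space {ξ : ℕ → Fin n × Bool //
    ∀ k : ℕ, ¬ ((ξ k).1 = (ξ (k + 1)).1 ∧ (ξ k).2 ≠ (ξ (k + 1)).2)})

instance : SecondCountableTopology (TreeBoundary n) :=
  TopologicalSpace.Subtype.secondCountableTopology {ξ : ℕ → Fin n × Bool |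
    ∀ k : ℕ, ¬ ((ξ k).1 = (ξ (k + 1)).1 ∧ (ξ k).2 ≠ (ξ (k + 1)).2)}

instance : CompactSpace (TreeBoundary n) := by
  have hclosed : IsClosed {ξ : ℕ → Fin n × Bool |
      ∀ k : ℕ, ¬ ((ξ k).1 = (ξ (k + 1)).1 ∧ (ξ k).2 ≠ (ξ (k + 1)).2)} := by
    have : {ξ : ℕ → Fin n × Bool |
        ∀ k : ℕ, ¬ ((ξ k).1 = (ξ (k + 1)).1 ∧ (ξ k).2 ≠ (ξ (k + 1)).2)} =
        ⋂ k, (fun ξ : ℕ → Fin n × Bool => (ξ k, ξ (k + 1))) ⁻¹'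
          {p | ¬ (p.1.1 = p.2.1 ∧ p.1.2 ≠ p.2.2)} := by
      ext ξ
      simp only [mem_iInter]
      rfl
    rw [this]
    exact isClosed_iInter fun k => (isClosed_discrete _).preimage
      ((continuous_apply k).prodMk (continuous_apply (k + 1)))
  exact isCompact_iff_compactSpace.1 hclosed.isCompact

namespace TreeBoundary

lemma continuous_letter (i : ℕ) : Continuous fun ξ : TreeBoundary n => ξ.1 i :=
  (continuous_apply i).comp continuous_subtype_val

/-- The set of boundary points whose first `k` letters are those of `ξ`. -/
def cylinder (ξ : TreeBoundary n) (k : ℕ) : Set (TreeBoundary n) :=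
  {η | η.initial k = ξ.initial k}

lemma isClopen_cylinder (ξ : TreeBoundary n) (k : ℕ) : IsClopen (ξ.cylinder k) := by
  have : ξ.cylinder k = ⋂ i ∈ Finset.range k, (fun η : TreeBoundary n => η.1 i) ⁻¹' {ξ.1 i} := by
    ext η
    simp [cylinder, initial_eq_iff]
  rw [this]
  exact isClopen_biInter_finset fun i _ => (isClopen_discrete _).preimage (continuous_letter i)

lemma exists_cylinder_subset {ξ : TreeBoundary n} {U : Set (TreeBoundary n)} (hU : IsOpen U)
    (hξ : ξ ∈ U) : ∃ k, ξ.cylinder k ⊆ U := by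
  obtain ⟨V, hV, rfl⟩ := isOpen_induced_iff.1 hU
  obtain ⟨I, u, hu, hIu⟩ := isOpen_pi_iff.1 hV _ hξ
  refine ⟨I.sup id + 1, fun η hη => hIu fun i hi => ?_⟩
  have h1 : i < I.sup id + 1 := Nat.lt_succ_of_le (Finset.le_sup (f := id) hi)
  rw [initial_eq_iff.1 hη i h1]
  exact (hu i hi).2

/-- For each `k`, the map `q` identifies only finitely many pairs of boundary points that differ in
their first `k` letters. -/
def IsFiniteIdentification {X : Type*} (q : TreeBoundary n → X) : Prop :=
  ∀ k, {p : TreeBoundary n × TreeBoundary n |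
    q p.1 = q p.2 ∧ p.1.initial k ≠ p.2.initial k}.Finite

variable {X : Type*} [TopologicalSpace X] {q : TreeBoundary n → X}

/-- The identified pairs form a closed set: outside the diagonal they are locally finite. -/
lemma IsFiniteIdentification.t2Space (hfin : IsFiniteIdentification q) (hq : IsQuotientMap q) :
    T2Space X := by
  refine hq.t2Space_of_isClosed ?_
  rw [← isOpen_compl_iff, isOpen_iff_mem_nhds]
  rintro ⟨ξ, η⟩ hne
  have hne' : q ξ ≠ q η := hne
  obtain ⟨k, hk⟩ : ∃ k, ξ.initial k ≠ η.initial k := by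
    by_contra! h
    exact hne' (congrArg q (ext_initial h))
  have h1 : ξ.cylinder k ×ˢ η.cylinder k ∈ 𝓝 (ξ, η) :=
    prod_mem_nhds ((ξ.isClopen_cylinder k).2.mem_nhds rfl)
      ((η.isClopen_cylinder k).2.mem_nhds rfl)
  have h2 := (hfin k).isClosed.isOpen_compl.mem_nhds
    (show (ξ, η) ∈ _ from fun h => hne' h.1)
  filter_upwards [h1, h2] with p hp hp' hpq
  refine hp' ⟨hpq, ?_⟩
  rw [show p.1.initial k = ξ.initial k from hp.1, show p.2.initial k = η.initial k from hp.2]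
  exact hk

lemma IsFiniteIdentification.locallyConnectedSpace (hfin : IsFiniteIdentification q)
    (hq : IsQuotientMap q) [PreconnectedSpace X] : LocallyConnectedSpace X := by
  have := hfin.t2Space hq
  refine locallyConnectedSpace_of_finite_crossingPoints hq fun ξ U hU hξ => ?_
  obtain ⟨k, hk⟩ := exists_cylinder_subset hU hξ
  refine ⟨ξ.cylinder k, ξ.isClopen_cylinder k, rfl, hk, ((hfin k).image Prod.fst).subset ?_⟩
  rintro a ⟨ha, b, hb, hab⟩
  exact ⟨(a, b), ⟨hab, fun e => hb (e.symm.trans ha)⟩, rfl⟩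

end TreeBoundary

end Boundary

/-! ### The decomposition space -/

section Decomposition

variable {F : Type*} [Group F] {n : ℕ} {b : FreeGroupBasis (Fin n) F} {W : Set F}

lemma IsLineEnds.exists_isAxis {ξ η : TreeBoundary n} (h : IsLineEnds b W ξ η) :
    ∃ w ∈ W, ∃ g, IsAxis g (b.repr w) ξ η := by
  obtain ⟨w, hw, g, h1, h2⟩ := h
  have hto : Tendsto Int.toNat atTop atTop := by
    refine tendsto_atTop.2 fun m => ?_
    filter_upwards [eventually_ge_atTop (m : ℤ)] with i hi
    omega
  refine ⟨w, hw, b.repr g, (h1.tendsToEnd.comp hto).congr' ?_, (h2.tendsToEnd.comp hto).congr' ?_⟩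
  all_goals
    filter_upwards [eventually_ge_atTop (0 : ℤ)] with i hi
    obtain ⟨m, rfl⟩ := Int.eq_ofNat_of_zero_le hi
    simp

/-- Boundary points that are identified are the two ends of one line, since a chain of lines with
common ends runs along a single line. -/
lemma exists_isAxis_of_mk_eq {ξ η : TreeBoundary n} (hne : ξ ≠ η)
    (h : Quot.mk (IsLineEnds b W) ξ = Quot.mk (IsLineEnds b W) η) :
    ∃ w ∈ b.repr '' W ∪ (b.repr '' W)⁻¹, ∃ g, IsAxis g w ξ η := by
  have h' := Quot.eqvGen_exact h
  have key : ∀ ξ η, Relation.EqvGen (IsLineEnds b W) ξ η →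
      ξ = η ∨ ∃ w ∈ b.repr '' W ∪ (b.repr '' W)⁻¹, ∃ g, IsAxis g w ξ η := by
    intro ξ η hr
    have hsymm : ∀ {ξ η : TreeBoundary n},
        (∃ w ∈ b.repr '' W ∪ (b.repr '' W)⁻¹, ∃ g, IsAxis g w ξ η) →
        ∃ w ∈ b.repr '' W ∪ (b.repr '' W)⁻¹, ∃ g, IsAxis g w η ξ := by
      rintro ξ η ⟨w, hw, g, h⟩
      refine ⟨w⁻¹, ?_, g, h.symm⟩
      rcases hw with hw | hw
      · exact Or.inr (by rwa [Set.mem_inv, inv_inv])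
      · exact Or.inl hw
    induction hr with
    | rel ξ η h =>
      obtain ⟨w, hw, g, h⟩ := h.exists_isAxis
      exact Or.inr ⟨_, Or.inl ⟨w, hw, rfl⟩, g, h⟩
    | refl ξ => exact Or.inl rfl
    | symm ξ η _ ih => exact ih.imp Eq.symm hsymm
    | trans ξ η ζ _ _ ih₁ ih₂ =>
      rcases ih₁ with rfl | h₁
      · exact ih₂
      rcases ih₂ with rfl | ⟨w₂, _, g₂, h₂⟩
      · exact Or.inr h₁
      obtain ⟨w₁, _, g₁, h₁⟩ := hsymm h₁
      exact Or.inl (h₁.eq_of_eq h₂)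
  exact (key ξ η h').resolve_left hne

namespace DecompositionSpace

variable (b W) in
/-- The quotient map from the boundary of the tree to the decomposition space. -/
def mk (ξ : TreeBoundary n) : DecompositionSpace b W := Quot.mk (IsLineEnds b W) ξ

lemma isQuotientMap_mk : IsQuotientMap (mk b W) := isQuotientMap_quot_mk

lemma isFiniteIdentification_mk (hfin : W.Finite) :
    TreeBoundary.IsFiniteIdentification (mk b W) := by
  intro k
  have hV : (b.repr '' W ∪ (b.repr '' W)⁻¹).Finite := (hfin.image _).union (hfin.image _).inv
  refine (IsAxis.finite_setOf hV k).subset ?_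
  rintro ⟨ξ, η⟩ ⟨h, hne⟩
  exact ⟨hne, exists_isAxis_of_mk_eq (fun e => hne (by rw [e])) h⟩

end DecompositionSpace

end Decomposition

theorem mainTheorem4 {F : Type*} [Group F] {n : ℕ} (hn : 1 < n)
    (b : FreeGroupBasis (Fin n) F) (W : Set F) (hfin : W.Finite) (hW : ∀ w ∈ W, w ≠ 1) :
    Nonempty (DecompositionSpace b W ≃ₜ Circle) ↔
      (ConnectedSpace (DecompositionSpace b W) ∧
        (∀ x : DecompositionSpace b W, ¬ IsCutPoint x) ∧
        (∃ x y : DecompositionSpace b W, IsCutPair x y) ∧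
        (∀ x y : DecompositionSpace b W, IsCutPair x y →
          ∃ u v : DecompositionSpace b W, IsCutPair u v ∧ Crosses u v x y)) := by
  constructor
  · rintro ⟨e⟩
    exact cutPair_conditions_of_homeomorph_circle e
  · rintro ⟨hconn, hnc, hpair, hcross⟩
    have hq := DecompositionSpace.isQuotientMap_mk (b := b) (W := W)
    have hI := DecompositionSpace.isFiniteIdentification_mk (b := b) hfin
    have : PreconnectedSpace (DecompositionSpace b W) := hconn.toPreconnectedSpace
    have : T2Space (DecompositionSpace b W) := hI.t2Space hq
    have : LocallyConnectedSpace (DecompositionSpace b W) := hI.locallyConnectedSpace hq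
    have : CompactSpace (DecompositionSpace b W) := hq.surjective.compactSpace hq.continuous
    have : TopologicalSpace.SeparableSpace (DecompositionSpace b W) :=
      hq.surjective.denseRange.separableSpace hq.continuous
    exact nonempty_homeomorph_circle_of_cutPair hnc hpair hcross
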